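/- There is a universal constant $C>0$ such that the following holds. Consider $n$ bidders (requests) with at most $K$ options each and $m$ resources with capacities $b_i\ge 0$; option $k$ of bidder $j$ has value $c_{j,k}\ge 0$ and consumes $a_{i,j,k}\ge 0$ units of resource $i$. For $f\ge 0$ and $S\subseteq[n]$ let $\mathcal P(f,S)$ be the set of all $x\ge 0$ with $\sum_{j,k}a_{i,j,k}x_{j,k}\le f\,b_i$ for all $i$, $\sum_k x_{j,k}\le 1$ for $j\in S$, and $x_{j,k}=0$ for $j\notin S$. Let $\mathrm{OPT}=\max_{x\in\mathcal P(1,[n])}c^Tx$ be the optimal (fractional) social welfare, and let $B=\min_i \frac{b_i}{\max_{j,k}a_{i,j,k}}$ be the capacity ratio (a resource with $b_i>0$ that nobody demands contributes $\infty$), with $B>0$. The bidders arrive in uniformly random order, and the mechanism maintains an allocation $y$, initially $0$. When the $\ell$-th bidder, say $j$, arrives, let $S$ be the set of the $\ell$ bidders seen so far. The mechanism (1) permanently removes every option $k$ of $j$ with $(Ay)_i+a_{i,j,k}>b_i$ for some $i$, i.e. sets its value $c_{j,k}$ to $0$ and does not use it; (2) computes, with the current values $c$, an optimal solution $\tilde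 x$ of $\max_{x\in\mathcal P(\ell/n,S)}c^Tx$ that does not use removed options, where the optimal solution is selected by a fixed deterministic rule that depends only on the instance, $S$ and the set of removed options, and not on the order of arrival; (3) charges $j$ the VCG payment $\max_{x\in\mathcal P(\ell/n,S\setminus\{j\})}c^Tx-\sum_{j'\in S\setminus\{j\}}\sum_k c_{j',k}\tilde x_{j',k}$; and (4) independently at random chooses option $k$ for $j$ with probability $\tilde x_{j,k}$, and no option with the remaining probability, and adds the chosen option permanently to $y$. Suppose that all reports are truthful. Then the final $y$ is always a feasible integral allocation, and for every such selection rule the expected social welfare satisfies $$\mathbb E[c^Ty]\ \ge\ \Bigl(1-C\sqrt{\tfrac{\log m}{B}}\Bigr)\,\mathrm{OPT},$$ where $c$ denotes the original (true) values and $\log m$ stands for $\max\{\log_2 m,1\}$. (If resource consumptions are normalized so that $\max_{j,k}a_{i,j,k}=1$ for every $i$, then $B=b_{\min}=\min_i b_i$.) -/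

import Mathlib

open scoped ENNReal

noncomputable section

namespace OnlinePacking

/-- A packing LP with `m` resources, `n` requests (bidders) and `K` options per request. In the
auction setting this is what the bidders report: their options, with values and demands. -/
structure Instance (m n K : ℕ) where
  cap : Fin m → ℝ
  profit : Fin n → Fin K → ℝ
  demand : Fin m → Fin n → Fin K → ℝ
  cap_nonneg : ∀ i, 0 ≤ cap i
  profit_nonneg : ∀ j k, 0 ≤ profit j k
  demand_nonneg : ∀ i j k, 0 ≤ demand i j k

variable {m n K : ℕ}

/-- The linear objective `cᵀ x`. -/
def value (c x : Fin n → Fin K → ℝ) : ℝ := ∑ j, ∑ k, c j k * x j k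

/-- `usage I x i` is `(A x)_i`. -/
def usage (I : Instance m n K) (x : Fin n → Fin K → ℝ) (i : Fin m) : ℝ :=
  ∑ j, ∑ k, I.demand i j k * x j k

/-- `polytope I f S` is the set `𝒫(f, S)` of fractional solutions that serve only requests in `S`
and respect the capacities scaled by `f`. -/
def polytope (I : Instance m n K) (f : ℝ) (S : Finset (Fin n)) : Set (Fin n → Fin K → ℝ) :=
  {x | (∀ j k, 0 ≤ x j k) ∧ (∀ i, usage I x i ≤ f * I.cap i) ∧
    (∀ j ∈ S, ∑ k, x j k ≤ 1) ∧ (∀ j ∉ S, ∀ k, x j k = 0)}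

/-- The maximum of `cᵀ x` over a (nonempty, compact) set of solutions `P`. -/
def maxValue (c : Fin n → Fin K → ℝ) (P : Set (Fin n → Fin K → ℝ)) : ℝ := sSup (value c '' P)

/-- The optimum of the full fractional LP. -/
def OPT (I : Instance m n K) : ℝ := maxValue I.profit (polytope I 1 Finset.univ)

/-- The capacity ratio `B = min_i (b_i / max_{j,k} a_{i,j,k})`. It takes values in `[0, ∞]`, as a
resource of positive capacity that nobody demands contributes `∞`. -/
def capacityRatio (I : Instance m n K) : ℝ≥0∞ :=
  ⨅ i, ENNReal.ofReal (I.cap i) / ⨆ j, ⨆ k, ENNReal.ofReal (I.demand i j k)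

/-- The convention `log k = max {log₂ k, 1}`. -/
def log' (k : ℕ) : ℝ := max (Real.logb 2 k) 1

open Classical in
/-- The profits after those of the removed options have been set to `0`. -/
def profitWithout (I : Instance m n K) (R : Finset (Fin n × Fin K)) : Fin n → Fin K → ℝ :=
  fun j k => if (j, k) ∈ R then 0 else I.profit j k

/-- The scaled polytope `𝒫(ℓ/n, S)` with `ℓ = |S|`. -/
abbrev scaledPolytope (I : Instance m n K) (S : Finset (Fin n)) : Set (Fin n → Fin K → ℝ) :=
  polytope I ((S.card : ℝ) / n) S

/-- A deterministic LP solver: for the known requests `S` and the removed options `R`, it returns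
an optimal solution of the scaled LP that does not use removed options. Ties are broken
arbitrarily, but not depending on the order in which the requests in `S` have arrived. -/
structure Solver (I : Instance m n K) where
  sol : Finset (Fin n) → Finset (Fin n × Fin K) → Fin n → Fin K → ℝ
  mem : ∀ S R, sol S R ∈ scaledPolytope I S
  optimal : ∀ S R, ∀ x ∈ scaledPolytope I S,
    value (profitWithout I R) x ≤ value (profitWithout I R) (sol S R)
  removed : ∀ S R j k, (j, k) ∈ R → sol S R j k = 0

theorem Solver.sum_le_one {I : Instance m n K} (A : Solver I) (S : Finset (Fin n))
    (R : Finset (Fin n × Fin K)) (j : Fin n) : ∑ k, A.sol S R j k ≤ 1 := by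
  by_cases hj : j ∈ S
  · exact (A.mem S R).2.2.1 j hj
  · simp [(A.mem S R).2.2.2 j hj]

/-- The probability with which randomized rounding of a row `p` (with `p k ≥ 0`, `∑ k, p k ≤ 1`)
chooses an option, or no option. -/
def roundProb (p : Fin K → ℝ) : Option (Fin K) → ℝ
  | some k => p k
  | none => 1 - ∑ k, p k

/-- Randomized rounding of the row of request `j` in the solution computed from `S` and `R`. -/
def rounding {I : Instance m n K} (A : Solver I) (S : Finset (Fin n))
    (R : Finset (Fin n × Fin K)) (j : Fin n) : PMF (Option (Fin K)) :=
  PMF.ofFintype (fun o => ENNReal.ofReal (roundProb (A.sol S R j) o)) (by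
    have h1 : ∀ o ∈ Finset.univ, 0 ≤ roundProb (A.sol S R j) o := by
      rintro (_ | k) _
      · exact sub_nonneg.2 (A.sum_le_one S R j)
      · exact (A.mem S R).1 j k
    rw [← ENNReal.ofReal_sum_of_nonneg h1]
    simp [Fintype.sum_option, roundProb])

/-- The state of the mechanism between two rounds: known requests, removed options, the permanent
allocation `y`, and the payments charged so far. -/
structure State (n K : ℕ) where
  seen : Finset (Fin n)
  removed : Finset (Fin n × Fin K)
  y : Fin n → Fin K → ℝ
  pay : Fin n → ℝ

/-- The initial state. -/
def State.init (n K : ℕ) : State n K := ⟨∅, ∅, 0, 0⟩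

open Classical in
/-- The options of request `j` that do not fit into the capacities left by `y`. -/
def infeasible (I : Instance m n K) (y : Fin n → Fin K → ℝ) (j : Fin n) :
    Finset (Fin n × Fin K) :=
  Finset.univ.filter fun q => q.1 = j ∧ ∃ i, I.cap i < usage I y i + I.demand i j q.2

/-- The unit vector of option `k` of request `j`, or `0` if no option is chosen. -/
def allocation (j : Fin n) : Option (Fin K) → Fin n → Fin K → ℝ
  | some k => Pi.single j (Pi.single k 1)
  | none => 0

/-- The VCG payment of request `j`, where `S` (containing `j`) is the set of known requests. -/
def vcgPayment {I : Instance m n K} (A : Solver I) (S : Finset (Fin n))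
    (R : Finset (Fin n × Fin K)) (j : Fin n) : ℝ :=
  maxValue (profitWithout I R) (polytope I ((S.card : ℝ) / n) (S.erase j)) -
    ∑ j' ∈ S.erase j, ∑ k, profitWithout I R j' k * A.sol S R j' k

/-- One round of the mechanism, in which request `j` arrives: remove the infeasible options of `j`,
solve the scaled LP, charge the VCG payment, round randomly, and allocate. -/
def step {I : Instance m n K} (A : Solver I) (j : Fin n) (s : State n K) : PMF (State n K) :=
  let S := insert j s.seen
  let R := s.removed ∪ infeasible I s.y j
  (rounding A S R j).map fun o =>
    ⟨S, R, s.y + allocation j o, Function.update s.pay j (vcgPayment A S R j)⟩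

/-- The mechanism on a list of requests, in the order of arrival. -/
def run {I : Instance m n K} (A : Solver I) : List (Fin n) → State n K → PMF (State n K)
  | [], s => PMF.pure s
  | j :: js, s => (step A j s).bind (run A js)

/-- The distribution of the final state of the mechanism when the requests arrive in uniformly
random order. -/
def mechanism {I : Instance m n K} (A : Solver I) : PMF (State n K) :=
  (PMF.uniformOfFintype (Equiv.Perm (Fin n))).bind fun σ => run A (List.ofFn σ) (State.init n K)

/-- The expected social welfare of the mechanism run on the reports `I`, if `v` are the true
valuations. (All but finitely many terms of the sum are zero.) -/
def expectedWelfare {I : Instance m n K} (A : Solver I) (v : Fin n → Fin K → ℝ) : ℝ :=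
  ∑' s, (mechanism A s).toReal * value v s.y

/-- `y` selects at most one option per request and respects the capacities. -/
def IsIntegralAllocation (I : Instance m n K) (y : Fin n → Fin K → ℝ) : Prop :=
  y ∈ polytope I 1 Finset.univ ∧ ∀ j k, y j k = 0 ∨ y j k = 1

end OnlinePacking

end

/-!
Feasibility holds by design: an option that does not fit is removed before the LP is solved, and
rounding only chooses options in the support of the LP solution.

For the welfare, the mechanism is compared with an idealized process that never removes options.
Both agree as long as the allocation leaves room for every option of every request
(`idealExp_le_expAfter`), and the value collected after that point is only bounded below by `0`. In
the idealized process, the LP solution used when the set `T` of requests is known depends on `T`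
alone, while the last arrival is uniform in `T` and the order of the others is uniform again. This
backward view has two consequences.

* Given the set `T` of the first `ℓ` requests, the exponential moments of the load of a resource
  multiply up round by round (`avgOrders_exp_load_le`), as if the increments were independent with
  mean at most a `1 / n` fraction of the capacity. A Chernoff bound then shows that, for *every* `T`,
  running out of room is unlikely unless almost all requests have arrived
  (`HasCapacityRatio.avgOrders_roomProb`). Since this is uniform in `T`, it can be multiplied with the
  expected value of the next round.
* The expected value of round `ℓ` is a `1 / ℓ` fraction of the LP optimum of a uniformly random
  `ℓ`-subset. Restricting a solution `x` of the full LP to the sample overloads the scaled capacities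
  only slightly: memberships in a random subset are negatively correlated (`containProb_le`), so
  exponential moments are bounded as for independent sampling (`avgSubsets_prod_le`), and scaling
  down loses little on average (`avgSubsets_value_sol`).

With `q = ℓ / n`, round `ℓ` thus contributes at least `1 / n` of the optimum, up to a relative loss of
`O(√(log' m / (q * B)))` from sampling and a loss that is exponentially small in `1 - q` from lack of
room. Both sum to `O(√(log' m / B))` over the rounds (`HasCapacityRatio.le_expectedWelfare`).
-/

noncomputable section

namespace OnlinePacking

variable {m n K : ℕ} {I : Instance m n K}

/-! ### Linear functionals and single allocations -/

theorem allocation_nonneg (j : Fin n) (o : Option (Fin K)) : 0 ≤ allocation j o := by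
  cases o with
  | none => exact le_rfl
  | some k =>
    intro j' k'
    simp only [allocation, Pi.single_apply, Pi.zero_apply]
    split_ifs <;> simp [Pi.single_apply]
    split_ifs <;> simp

theorem sum_mul_allocation (w : Fin n → Fin K → ℝ) (j : Fin n) (o : Option (Fin K)) :
    ∑ j', ∑ k, w j' k * allocation j o j' k = o.elim 0 (w j) := by
  cases o with
  | none => simp [allocation]
  | some k =>
    rw [Finset.sum_eq_single j]
    · simp [allocation, Pi.single_apply]
    · intro j' _ h
      simp [allocation, Pi.single_eq_of_ne h]
    · simp

theorem value_add (c x y : Fin n → Fin K → ℝ) : value c (x + y) = value c x + value c y := by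
  simp [value, mul_add, Finset.sum_add_distrib]

theorem usage_add (x y : Fin n → Fin K → ℝ) (i : Fin m) :
    usage I (x + y) i = usage I x i + usage I y i := by
  simp [usage, mul_add, Finset.sum_add_distrib]

theorem value_nonneg {c x : Fin n → Fin K → ℝ} (hc : ∀ j k, 0 ≤ c j k) (hx : 0 ≤ x) :
    0 ≤ value c x :=
  Finset.sum_nonneg fun j _ => Finset.sum_nonneg fun k _ => mul_nonneg (hc j k) (hx j k)

theorem usage_nonneg {x : Fin n → Fin K → ℝ} (hx : 0 ≤ x) (i : Fin m) : 0 ≤ usage I x i :=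
  Finset.sum_nonneg fun j _ => Finset.sum_nonneg fun k _ =>
    mul_nonneg (I.demand_nonneg i j k) (hx j k)

theorem roundProb_nonneg (A : Solver I) (S : Finset (Fin n)) (R : Finset (Fin n × Fin K))
    (j : Fin n) (o : Option (Fin K)) : 0 ≤ roundProb (A.sol S R j) o := by
  cases o with
  | none => exact sub_nonneg.2 (A.sum_le_one S R j)
  | some k => exact (A.mem S R).1 j k

theorem sum_roundProb (p : Fin K → ℝ) : ∑ o, roundProb p o = 1 := by
  simp [Fintype.sum_option, roundProb]

theorem sum_roundProb_mul_elim (p w : Fin K → ℝ) :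
    ∑ o, roundProb p o * o.elim 0 w = ∑ k, w k * p k := by
  simp [Fintype.sum_option, roundProb, mul_comm]

/-! ### Feasibility of the final allocation -/

/-- The state after request `j` has arrived in state `s` and randomized rounding has chosen `o`. -/
def nextState (A : Solver I) (j : Fin n) (s : State n K) (o : Option (Fin K)) : State n K :=
  ⟨insert j s.seen, s.removed ∪ infeasible I s.y j, s.y + allocation j o,
    Function.update s.pay j
      (vcgPayment A (insert j s.seen) (s.removed ∪ infeasible I s.y j) j)⟩

theorem step_eq (A : Solver I) (j : Fin n) (s : State n K) :
    step A j s = (rounding A (insert j s.seen) (s.removed ∪ infeasible I s.y j) j).map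
      (nextState A j s) := rfl

/-- The invariant behind feasibility: the allocation is integral and feasible, and requests that
have not arrived yet have received nothing. -/
def Invariant (I : Instance m n K) (s : State n K) : Prop :=
  IsIntegralAllocation I s.y ∧ ∀ j ∉ s.seen, ∀ k, s.y j k = 0

theorem Invariant.init : Invariant I (State.init n K) := by
  refine ⟨⟨⟨fun _ _ => le_rfl, fun i => ?_, fun _ _ => ?_, by simp⟩, fun _ _ => Or.inl rfl⟩,
    fun _ _ _ => rfl⟩
  · simpa [State.init, usage] using I.cap_nonneg i
  · simp [State.init]

/-- An option that does not fit is removed before the LP is solved, so rounding never chooses it. -/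
theorem Invariant.step {A : Solver I} {j : Fin n} {s s' : State n K} (h : Invariant I s)
    (hj : j ∉ s.seen) (hs' : s' ∈ (step A j s).support) :
    Invariant I s' ∧ s'.seen = insert j s.seen := by
  rw [step_eq, PMF.support_map] at hs'
  obtain ⟨o, ho, rfl⟩ := hs'
  refine ⟨?_, rfl⟩
  cases o with
  | none =>
    refine ⟨by simpa [nextState, allocation] using h.1, fun j' hj' k => ?_⟩
    simp only [nextState, Finset.mem_insert, not_or] at hj'
    simpa [nextState, allocation] using h.2 j' hj'.2 k
  | some k =>
    have hrem : (j, k) ∉ s.removed ∪ infeasible I s.y j := by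
      intro hmem
      rw [PMF.mem_support_iff] at ho
      apply ho
      simp [rounding, roundProb, A.removed _ _ j k hmem]
    have hfit : ∀ i, usage I s.y i + I.demand i j k ≤ I.cap i := by
      intro i
      by_contra hlt
      exact hrem (Finset.mem_union_right _ (by simpa [infeasible] using ⟨i, not_le.1 hlt⟩))
    have hrow : ∀ j' k', (s.y + allocation j (some k)) j' k' =
        if j' = j then (if k' = k then 1 else 0) else s.y j' k' := by
      intro j' k'
      by_cases h1 : j' = j
      · subst h1
        simp [allocation, h.2 j' hj k', Pi.single_apply]
      · simp [allocation, h1]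
    obtain ⟨⟨⟨h0, -, h2, -⟩, h01⟩, hseen⟩ := h
    refine ⟨⟨⟨fun j' k' => ?_, fun i => ?_, fun j' _ => ?_, by simp⟩, fun j' k' => ?_⟩,
      fun j' hj' k' => ?_⟩
    · simp only [nextState, hrow]
      split_ifs
      exacts [zero_le_one, le_rfl, h0 j' k']
    · simp only [nextState, usage_add, one_mul]
      rw [show usage I (allocation j (some k)) i = I.demand i j k from
        sum_mul_allocation (fun j k => I.demand i j k) j (some k)]
      exact hfit i
    · simp only [nextState, hrow]
      by_cases h1 : j' = j
      · simp [h1]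
      · simpa [h1] using h2 j' (Finset.mem_univ _)
    · simp only [nextState, hrow]
      split_ifs
      exacts [Or.inr rfl, Or.inl rfl, h01 j' k']
    · simp only [nextState, Finset.mem_insert, not_or] at hj'
      simp only [nextState, hrow, if_neg hj'.1]
      exact hseen j' hj'.2 k'

theorem Invariant.run {A : Solver I} {l : List (Fin n)} {s s' : State n K} (h : Invariant I s)
    (hl : l.Nodup) (hd : ∀ j ∈ l, j ∉ s.seen) (hs' : s' ∈ (run A l s).support) :
    Invariant I s' := by
  induction l generalizing s with
  | nil =>
    simp only [OnlinePacking.run, PMF.support_pure, Set.mem_singleton_iff] at hs'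
    exact hs' ▸ h
  | cons j l ih =>
    simp only [OnlinePacking.run, PMF.mem_support_bind_iff] at hs'
    obtain ⟨t, ht, hs'⟩ := hs'
    obtain ⟨hinv, hseen⟩ := h.step (hd j (by simp)) ht
    rw [List.nodup_cons] at hl
    refine ih hinv hl.2 (fun j' hj' => ?_) hs'
    rw [hseen, Finset.mem_insert, not_or]
    exact ⟨fun e => hl.1 (e ▸ hj'), hd j' (List.mem_cons_of_mem _ hj')⟩

theorem isIntegralAllocation_of_mem_support (A : Solver I) {s : State n K}
    (hs : s ∈ (mechanism A).support) : IsIntegralAllocation I s.y := by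
  simp only [mechanism, PMF.mem_support_bind_iff] at hs
  obtain ⟨σ, -, hσ⟩ := hs
  exact (Invariant.init.run (List.nodup_ofFn.2 σ.injective) (by simp [State.init]) hσ).1

/-! ### Expectations along a fixed order of arrival -/

/-- The expectation of `g` over the state of the mechanism after the requests in `r` have arrived.
The list is in reverse order of arrival: its head arrives last. -/
def expAfter (A : Solver I) : List (Fin n) → (State n K → ℝ) → ℝ
  | [], g => g (State.init n K)
  | j :: r, g => expAfter A r fun s =>
      ∑ o, roundProb (A.sol (insert j s.seen) (s.removed ∪ infeasible I s.y j) j) o *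
        g (nextState A j s o)

/-- Expectations are monotone, and only states with a nonnegative allocation matter. -/
theorem expAfter_mono (A : Solver I) (r : List (Fin n)) {g g' : State n K → ℝ}
    (h : ∀ s, 0 ≤ s.y → g s ≤ g' s) : expAfter A r g ≤ expAfter A r g' := by
  induction r generalizing g g' with
  | nil => exact h _ le_rfl
  | cons j r ih =>
    refine ih fun s hs => Finset.sum_le_sum fun o _ => ?_
    exact mul_le_mul_of_nonneg_left (h _ (add_nonneg hs (allocation_nonneg j o)))
      (roundProb_nonneg A _ _ j o)

theorem expAfter_add (A : Solver I) (r : List (Fin n)) (g g' : State n K → ℝ) :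
    expAfter A r (fun s => g s + g' s) = expAfter A r g + expAfter A r g' := by
  induction r generalizing g g' with
  | nil => rfl
  | cons j r ih => simp only [expAfter, mul_add, Finset.sum_add_distrib, ih]

theorem run_append (A : Solver I) (l : List (Fin n)) (j : Fin n) (s : State n K) :
    run A (l ++ [j]) s = (run A l s).bind (step A j) := by
  induction l generalizing s with
  | nil =>
    change (step A j s).bind (fun s => PMF.pure s) = (PMF.pure s).bind _
    rw [PMF.pure_bind]
    exact PMF.bind_pure _
  | cons j' l ih =>
    simp only [List.cons_append, run, PMF.bind_bind]
    congr 1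
    funext t
    exact ih t

/-- The expectation of a nonnegative function with respect to a discrete distribution. -/
def lexp {α : Type*} (p : PMF α) (g : α → ℝ≥0∞) : ℝ≥0∞ := ∑' a, p a * g a

theorem lexp_bind {α β : Type*} (p : PMF α) (q : α → PMF β) (g : β → ℝ≥0∞) :
    lexp (p.bind q) g = lexp p fun a => lexp (q a) g := by
  simp only [lexp, PMF.bind_apply, ← ENNReal.tsum_mul_right, ← ENNReal.tsum_mul_left]
  rw [ENNReal.tsum_comm]
  simp only [mul_assoc]

theorem lexp_pure {α : Type*} (a : α) (g : α → ℝ≥0∞) : lexp (PMF.pure a) g = g a := by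
  rw [lexp, tsum_eq_single a]
  · simp
  · intro b hb
    simp [PMF.pure_apply, hb]

theorem lexp_map {α β : Type*} (p : PMF α) (f : α → β) (g : β → ℝ≥0∞) :
    lexp (p.map f) g = lexp p (g ∘ f) := by
  rw [PMF.map, lexp_bind]
  simp [lexp_pure, Function.comp_def]

theorem lexp_run (A : Solver I) (r : List (Fin n)) {g : State n K → ℝ} (hg : ∀ s, 0 ≤ g s) :
    lexp (run A r.reverse (State.init n K)) (fun s => ENNReal.ofReal (g s)) =
      ENNReal.ofReal (expAfter A r g) := by
  induction r generalizing g with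
  | nil => exact lexp_pure _ _
  | cons j r ih =>
    rw [List.reverse_cons, run_append, lexp_bind, expAfter, ← ih]
    · congr 1
      funext s
      rw [step_eq, lexp_map, lexp, tsum_fintype, ENNReal.ofReal_sum_of_nonneg]
      · refine Finset.sum_congr rfl fun o _ => ?_
        rw [ENNReal.ofReal_mul (roundProb_nonneg A _ _ j o)]
        rfl
      · exact fun o _ => mul_nonneg (roundProb_nonneg A _ _ j o) (hg _)
    · exact fun s => Finset.sum_nonneg fun o _ =>
        mul_nonneg (roundProb_nonneg A _ _ j o) (hg _)

/-- The expected welfare is an average over the orders of arrival. -/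
theorem expectedWelfare_eq (A : Solver I) :
    expectedWelfare A I.profit = (∑ σ : Equiv.Perm (Fin n),
      expAfter A (List.ofFn σ).reverse fun s => value I.profit s.y) / n.factorial := by
  -- The positive part makes the integrand nonnegative everywhere without changing it on the
  -- support of the mechanism.
  set g : State n K → ℝ := fun s => max (value I.profit s.y) 0 with hg
  have hg0 : ∀ s, 0 ≤ g s := fun s => le_max_right _ _
  have h1 : expectedWelfare A I.profit =
      (lexp (mechanism A) fun s => ENNReal.ofReal (g s)).toReal := by
    rw [lexp, ENNReal.tsum_toReal_eq fun s =>
      ENNReal.mul_ne_top (PMF.apply_ne_top _ _) ENNReal.ofReal_ne_top]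
    refine tsum_congr fun s => ?_
    rw [ENNReal.toReal_mul, ENNReal.toReal_ofReal (hg0 s)]
    by_cases hs : s ∈ (mechanism A).support
    · have h0 := value_nonneg I.profit_nonneg (isIntegralAllocation_of_mem_support A hs).1.1
      simp only [hg, max_eq_left h0]
    · rw [PMF.mem_support_iff, not_not] at hs
      simp [hs]
  have h2 : ∀ r, expAfter A r g = expAfter A r fun s => value I.profit s.y := by
    intro r
    have : ∀ s : State n K, 0 ≤ s.y → g s = value I.profit s.y := fun s hs =>
      max_eq_left (value_nonneg I.profit_nonneg hs)
    exact le_antisymm (expAfter_mono A r fun s hs => (this s hs).le)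
      (expAfter_mono A r fun s hs => (this s hs).ge)
  have h3 : ∀ σ : Equiv.Perm (Fin n),
      0 ≤ expAfter A (List.ofFn σ).reverse fun s => value I.profit s.y := by
    intro σ
    have h0 : ∀ r, expAfter A r (fun _ => 0) = 0 := by
      intro r
      have := expAfter_add A r (fun _ => 0) (fun _ => 0)
      simpa using this
    rw [← h0 (List.ofFn σ).reverse]
    exact expAfter_mono A _ fun s hs => value_nonneg I.profit_nonneg hs
  rw [h1, mechanism, lexp_bind]
  have h4 : ∀ σ : Equiv.Perm (Fin n),
      lexp (run A (List.ofFn σ) (State.init n K)) (fun s => ENNReal.ofReal (g s)) =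
        ENNReal.ofReal (expAfter A (List.ofFn σ).reverse fun s => value I.profit s.y) := by
    intro σ
    rw [← h2, ← lexp_run A _ hg0, List.reverse_reverse]
  simp only [h4]
  rw [lexp, tsum_fintype]
  simp only [PMF.uniformOfFintype_apply, ← Finset.mul_sum]
  rw [ENNReal.toReal_mul, ← ENNReal.ofReal_sum_of_nonneg fun σ _ => h3 σ,
    ENNReal.toReal_ofReal (Finset.sum_nonneg fun σ _ => h3 σ)]
  simp [Fintype.card_perm, div_eq_inv_mul]

/-! ### The idealized process without removals -/

/-- The expectation of `f` over the allocation after the requests in `r` have arrived (the head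
arrives last), in the idealized process that never removes an option. -/
def idealExp (A : Solver I) : List (Fin n) → ((Fin n → Fin K → ℝ) → ℝ) → ℝ
  | [], f => f 0
  | j :: r, f => idealExp A r fun y =>
      ∑ o, roundProb (A.sol (insert j r.toFinset) ∅ j) o * f (y + allocation j o)

theorem idealExp_mono (A : Solver I) (r : List (Fin n)) {f f' : (Fin n → Fin K → ℝ) → ℝ}
    (h : ∀ y, f y ≤ f' y) : idealExp A r f ≤ idealExp A r f' := by
  induction r generalizing f f' with
  | nil => exact h _
  | cons j r ih =>
    exact ih fun y => Finset.sum_le_sum fun o _ =>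
      mul_le_mul_of_nonneg_left (h _) (roundProb_nonneg A _ _ j o)

theorem idealExp_mul_left (A : Solver I) (r : List (Fin n)) (c : ℝ)
    (f : (Fin n → Fin K → ℝ) → ℝ) : idealExp A r (fun y => c * f y) = c * idealExp A r f := by
  induction r generalizing f with
  | nil => rfl
  | cons j r ih => simp only [idealExp, mul_left_comm _ c, ← Finset.mul_sum, ih]

theorem idealExp_const (A : Solver I) (r : List (Fin n)) (c : ℝ) :
    idealExp A r (fun _ => c) = c := by
  induction r with
  | nil => rfl
  | cons j r ih => simp only [idealExp, ← Finset.sum_mul, sum_roundProb, one_mul, ih]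

theorem idealExp_add (A : Solver I) (r : List (Fin n)) (f f' : (Fin n → Fin K → ℝ) → ℝ) :
    idealExp A r (fun y => f y + f' y) = idealExp A r f + idealExp A r f' := by
  induction r generalizing f f' with
  | nil => rfl
  | cons j r ih => simp only [idealExp, mul_add, Finset.sum_add_distrib, ih]

theorem idealExp_sum {ι : Type*} (A : Solver I) (r : List (Fin n)) (s : Finset ι)
    (f : ι → (Fin n → Fin K → ℝ) → ℝ) :
    idealExp A r (fun y => ∑ i ∈ s, f i y) = ∑ i ∈ s, idealExp A r (f i) := by
  classical
  induction s using Finset.induction_on with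
  | empty => simpa using idealExp_const A r 0
  | insert i s hi ih => simp only [Finset.sum_insert hi, idealExp_add, ih]

/-- The allocation `y` leaves room for every single option of every request. -/
def HasRoom (I : Instance m n K) (y : Fin n → Fin K → ℝ) : Prop :=
  ∀ i j k, usage I y i + I.demand i j k ≤ I.cap i

theorem HasRoom.of_add {y : Fin n → Fin K → ℝ} {j : Fin n} {o : Option (Fin K)}
    (h : HasRoom I (y + allocation j o)) : HasRoom I y := by
  intro i j' k
  have h1 := h i j' k
  have h2 := usage_nonneg (I := I) (allocation_nonneg j o) i
  rw [usage_add] at h1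
  linarith

theorem HasRoom.infeasible_eq {y : Fin n → Fin K → ℝ} (h : HasRoom I y) (j : Fin n) :
    infeasible I y j = ∅ := by
  simp only [infeasible, Finset.filter_eq_empty_iff]
  rintro ⟨j', k⟩ - ⟨-, i, hi⟩
  exact absurd (h i j k) (not_le.2 hi)

open Classical in
/-- As usage only grows, the mechanism has removed nothing, and coincides with the idealized
process, as long as the latter has room. -/
theorem idealExp_le_expAfter (A : Solver I) (r : List (Fin n))
    {g : Finset (Fin n) → Finset (Fin n × Fin K) → (Fin n → Fin K → ℝ) → ℝ}
    (hg : ∀ S R y, 0 ≤ g S R y) :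
    idealExp A r (fun y => if HasRoom I y then g r.toFinset ∅ y else 0) ≤
      expAfter A r fun s => g s.seen s.removed s.y := by
  induction r generalizing g with
  | nil =>
    simp only [idealExp, expAfter, State.init, List.toFinset_nil]
    split_ifs
    exacts [le_rfl, hg _ _ _]
  | cons j r ih =>
    refine le_trans (idealExp_mono A r fun y => ?_)
      (ih (g := fun S R y => ∑ o, roundProb (A.sol (insert j S) (R ∪ infeasible I y j) j) o *
        g (insert j S) (R ∪ infeasible I y j) (y + allocation j o)) fun S R y =>
          Finset.sum_nonneg fun o _ => mul_nonneg (roundProb_nonneg A _ _ j o) (hg _ _ _))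
    by_cases hy : HasRoom I y
    · simp only [if_pos hy, hy.infeasible_eq, Finset.union_empty, List.toFinset_cons]
      refine Finset.sum_le_sum fun o _ =>
        mul_le_mul_of_nonneg_left ?_ (roundProb_nonneg A _ _ j o)
      split_ifs
      exacts [le_rfl, hg _ _ _]
    · rw [if_neg hy]
      refine (Finset.sum_eq_zero fun o _ => ?_).le
      have : ¬ HasRoom I (y + allocation j o) := fun h => hy h.of_add
      simp only [if_neg this, mul_zero]

/-- The expected value that request `j` contributes when it is rounded from the LP solution for
the set `S`, with nothing removed. -/
def gain (A : Solver I) (S : Finset (Fin n)) (j : Fin n) : ℝ :=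
  ∑ k, I.profit j k * A.sol S ∅ j k

theorem gain_nonneg (A : Solver I) (S : Finset (Fin n)) (j : Fin n) : 0 ≤ gain A S j :=
  Finset.sum_nonneg fun k _ => mul_nonneg (I.profit_nonneg j k) ((A.mem S ∅).1 j k)

open Classical in
/-- The probability that the idealized process has room after the requests in `r`. -/
def roomProb (A : Solver I) (r : List (Fin n)) : ℝ :=
  idealExp A r fun y => if HasRoom I y then 1 else 0

theorem expAfter_value_cons (A : Solver I) (j : Fin n) (r : List (Fin n)) :
    (expAfter A r fun s => value I.profit s.y) +
        gain A (insert j r.toFinset) j * roomProb A r ≤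
      expAfter A (j :: r) fun s => value I.profit s.y := by
  classical
  have h1 : (expAfter A (j :: r) fun s => value I.profit s.y) =
      expAfter A r fun s => value I.profit s.y + ∑ k, I.profit j k *
        A.sol (insert j s.seen) (s.removed ∪ infeasible I s.y j) j k := by
    rw [expAfter]
    congr 1
    funext s
    simp only [nextState, value_add, mul_add, Finset.sum_add_distrib, ← Finset.sum_mul,
      sum_roundProb, one_mul]
    congr 1
    rw [← sum_roundProb_mul_elim]
    exact Finset.sum_congr rfl fun o _ => congrArg _ (sum_mul_allocation I.profit j o)
  rw [h1, expAfter_add]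
  gcongr
  refine le_trans (le_of_eq ?_) (idealExp_le_expAfter A r
    (g := fun S R y => ∑ k, I.profit j k * A.sol (insert j S) (R ∪ infeasible I y j) j k)
    fun S R y => Finset.sum_nonneg fun k _ =>
      mul_nonneg (I.profit_nonneg j k) ((A.mem _ _).1 j k))
  rw [roomProb, ← idealExp_mul_left]
  congr 1
  funext y
  by_cases hy : HasRoom I y
  · simp [hy, hy.infeasible_eq, gain]
  · simp [hy]

/-! ### Averages over orders of arrival and over random subsets -/

/-- The orderings of a finite set, as lists without repetition. -/
def orders (T : Finset (Fin n)) : Finset (List (Fin n)) := T.val.lists.toFinset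

theorem mem_orders {T : Finset (Fin n)} {r : List (Fin n)} :
    r ∈ orders T ↔ (r : Multiset (Fin n)) = T.val := by
  rw [orders, Multiset.mem_toFinset, Multiset.mem_lists_iff]
  exact eq_comm

theorem mem_orders_iff {T : Finset (Fin n)} {r : List (Fin n)} :
    r ∈ orders T ↔ r.Nodup ∧ r.toFinset = T := by
  rw [mem_orders]
  constructor
  · intro h
    have hn : r.Nodup := by
      rw [← Multiset.coe_nodup, h]
      exact T.nodup
    refine ⟨hn, ?_⟩
    ext a
    rw [List.mem_toFinset, ← Multiset.mem_coe, h, Finset.mem_val]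
  · rintro ⟨hn, rfl⟩
    rw [List.toFinset_val, hn.dedup]

/-- The average over the orderings of `T`. -/
def avgOrders (T : Finset (Fin n)) (f : List (Fin n) → ℝ) : ℝ :=
  (∑ r ∈ orders T, f r) / T.card.factorial

/-- The average over the elements `j` of `T` of the values of `f` at `T` without `j`. -/
def avgErase (f : Finset (Fin n) → ℝ) (T : Finset (Fin n)) : ℝ :=
  (∑ j ∈ T, f (T.erase j)) / T.card

theorem sum_orders {T : Finset (Fin n)} (hT : T.Nonempty) (f : List (Fin n) → ℝ) :
    ∑ r ∈ orders T, f r = ∑ j ∈ T, ∑ r ∈ orders (T.erase j), f (j :: r) := by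
  rw [Finset.sum_sigma']
  symm
  refine Finset.sum_bij (fun p _ => p.1 :: p.2) ?_ ?_ ?_ fun _ _ => rfl
  · rintro ⟨j, r⟩ h
    simp only [Finset.mem_sigma, mem_orders_iff] at h
    obtain ⟨hj, hn, hr⟩ := h
    rw [mem_orders_iff, List.nodup_cons, List.toFinset_cons, hr, Finset.insert_erase hj,
      ← List.mem_toFinset, hr]
    exact ⟨⟨Finset.notMem_erase j T, hn⟩, rfl⟩
  · rintro ⟨j, r⟩ _ ⟨j', r'⟩ _ h
    simp only [List.cons.injEq] at h
    obtain ⟨rfl, rfl⟩ := h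
    rfl
  · intro l hl
    rw [mem_orders_iff] at hl
    obtain ⟨hn, rfl⟩ := hl
    cases l with
    | nil => simp at hT
    | cons j r =>
      rw [List.nodup_cons] at hn
      refine ⟨⟨j, r⟩, ?_, rfl⟩
      simp only [Finset.mem_sigma, mem_orders_iff]
      refine ⟨by simp, hn.2, ?_⟩
      rw [List.toFinset_cons, Finset.erase_insert]
      simpa using hn.1

/-- The last element of a random ordering is uniformly distributed, and the others are randomly
ordered. -/
theorem avgOrders_eq {T : Finset (Fin n)} (hT : T.Nonempty) (f : List (Fin n) → ℝ) :
    avgOrders T f = (∑ j ∈ T, avgOrders (T.erase j) fun r => f (j :: r)) / T.card := by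
  have hc : 0 < T.card := hT.card_pos
  simp only [avgOrders]
  have h1 : ∀ j ∈ T, (∑ r ∈ orders (T.erase j), f (j :: r)) / ((T.erase j).card.factorial : ℝ) =
      (∑ r ∈ orders (T.erase j), f (j :: r)) / (T.card - 1).factorial := fun j hj => by
    rw [Finset.card_erase_of_mem hj]
  rw [sum_orders hT, Finset.sum_congr rfl h1, ← Finset.sum_div, div_div,
    ← Nat.mul_factorial_pred hc.ne', Nat.cast_mul, mul_comm (T.card : ℝ)]

theorem avgOrders_empty (f : List (Fin n) → ℝ) : avgOrders ∅ f = f [] := by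
  have : orders (∅ : Finset (Fin n)) = {[]} := by
    ext r
    simp [mem_orders]
  simp [avgOrders, this]

theorem avgOrders_mono {T : Finset (Fin n)} {f g : List (Fin n) → ℝ}
    (h : ∀ r ∈ orders T, f r ≤ g r) : avgOrders T f ≤ avgOrders T g := by
  simp only [avgOrders]
  gcongr with r hr
  exact h r hr

theorem avgOrders_add (T : Finset (Fin n)) (f g : List (Fin n) → ℝ) :
    avgOrders T (fun r => f r + g r) = avgOrders T f + avgOrders T g := by
  simp only [avgOrders, Finset.sum_add_distrib, add_div]

theorem avgOrders_mul_left (T : Finset (Fin n)) (c : ℝ) (f : List (Fin n) → ℝ) :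
    avgOrders T (fun r => c * f r) = c * avgOrders T f := by
  simp only [avgOrders, ← Finset.mul_sum, mul_div_assoc]

theorem avgOrders_sum {ι : Type*} (T : Finset (Fin n)) (s : Finset ι)
    (f : ι → List (Fin n) → ℝ) :
    avgOrders T (fun r => ∑ i ∈ s, f i r) = ∑ i ∈ s, avgOrders T (f i) := by
  simp only [avgOrders]
  rw [Finset.sum_comm, Finset.sum_div]

theorem avgOrders_const (T : Finset (Fin n)) (c : ℝ) : avgOrders T (fun _ => c) = c := by
  induction T using Finset.strongInduction with
  | H T ih =>
    rcases T.eq_empty_or_nonempty with rfl | hT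
    · exact avgOrders_empty _
    · rw [avgOrders_eq hT, Finset.sum_congr rfl fun j hj => ih _ (Finset.erase_ssubset hj),
        Finset.sum_const, nsmul_eq_mul, mul_div_cancel_left₀]
      exact_mod_cast hT.card_pos.ne'

theorem sum_perm_eq_avgOrders (f : List (Fin n) → ℝ) :
    (∑ σ : Equiv.Perm (Fin n), f (List.ofFn σ).reverse) / n.factorial =
      avgOrders Finset.univ f := by
  rw [avgOrders, Finset.card_univ, Fintype.card_fin]
  congr 1
  refine Finset.sum_bij (fun σ _ => (List.ofFn σ).reverse) ?_ ?_ ?_ fun _ _ => rfl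
  · intro σ _
    rw [mem_orders_iff, List.nodup_reverse, List.toFinset_reverse]
    refine ⟨List.nodup_ofFn.2 σ.injective, Finset.eq_univ_of_forall fun a => ?_⟩
    rw [List.mem_toFinset, List.mem_ofFn]
    exact σ.surjective a
  · intro σ _ τ _ h
    exact DFunLike.coe_injective (List.ofFn_injective (List.reverse_injective h))
  · intro r hr
    rw [mem_orders_iff] at hr
    obtain ⟨hn, hr⟩ := hr
    have hlen : r.reverse.length = n := by
      rw [List.length_reverse, ← List.toFinset_card_of_nodup hn, hr, Finset.card_univ,
        Fintype.card_fin]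
    have hinj : Function.Injective fun i : Fin n => r.reverse.get (Fin.cast hlen.symm i) :=
      (List.nodup_iff_injective_get.1 (List.nodup_reverse.2 hn)).comp (Fin.cast_injective _)
    refine ⟨Equiv.ofBijective _ (Finite.injective_iff_bijective.1 hinj), Finset.mem_univ _, ?_⟩
    rw [List.reverse_eq_iff]
    refine List.ext_get (by simp [hlen]) fun i h1 h2 => ?_
    simp

/-- The average over the subsets of cardinality `n - k`, obtained by removing `k` times in a row a
uniformly random element. -/
def avgSubsets (n k : ℕ) (f : Finset (Fin n) → ℝ) : ℝ := (avgErase^[k] f) Finset.univ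

theorem avgSubsets_zero (f : Finset (Fin n) → ℝ) : avgSubsets n 0 f = f Finset.univ := rfl

theorem avgSubsets_avgErase (k : ℕ) (f : Finset (Fin n) → ℝ) :
    avgSubsets n k (avgErase f) = avgSubsets n (k + 1) f := rfl

theorem avgSubsets_mono (k : ℕ) {f g : Finset (Fin n) → ℝ}
    (h : ∀ T, T.card + k = n → f T ≤ g T) : avgSubsets n k f ≤ avgSubsets n k g := by
  induction k generalizing f g with
  | zero => exact h _ (by simp)
  | succ k ih =>
    refine ih fun T hT => ?_
    simp only [avgErase]
    gcongr with j hj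
    refine h _ ?_
    have := Finset.card_erase_add_one hj
    omega

theorem avgSubsets_congr (k : ℕ) {f g : Finset (Fin n) → ℝ}
    (h : ∀ T, T.card + k = n → f T = g T) : avgSubsets n k f = avgSubsets n k g :=
  le_antisymm (avgSubsets_mono k fun T hT => (h T hT).le)
    (avgSubsets_mono k fun T hT => (h T hT).ge)

theorem avgSubsets_add (k : ℕ) (f g : Finset (Fin n) → ℝ) :
    avgSubsets n k (fun T => f T + g T) = avgSubsets n k f + avgSubsets n k g := by
  induction k generalizing f g with
  | zero => rfl
  | succ k ih =>
    simp only [← avgSubsets_avgErase, ← ih]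
    congr 1
    funext T
    simp only [avgErase, Finset.sum_add_distrib, add_div]

theorem avgSubsets_mul_left (k : ℕ) (c : ℝ) (f : Finset (Fin n) → ℝ) :
    avgSubsets n k (fun T => c * f T) = c * avgSubsets n k f := by
  induction k generalizing f with
  | zero => rfl
  | succ k ih =>
    simp only [← avgSubsets_avgErase, ← ih]
    congr 1
    funext T
    simp only [avgErase, ← Finset.mul_sum, mul_div_assoc]

theorem avgSubsets_sum {ι : Type*} (k : ℕ) (s : Finset ι) (f : ι → Finset (Fin n) → ℝ) :
    avgSubsets n k (fun T => ∑ i ∈ s, f i T) = ∑ i ∈ s, avgSubsets n k (f i) := by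
  classical
  induction s using Finset.induction_on with
  | empty =>
    have := avgSubsets_mul_left (n := n) k 0 fun _ => 0
    simpa using this
  | insert i s hi ih => simp only [Finset.sum_insert hi, avgSubsets_add, ih]

/-- If `f` gains at least `g` in each step from a smaller to a larger set, then at the full set it
is at least the sum of the average gains. -/
theorem sum_avgSubsets_le {f g : Finset (Fin n) → ℝ} (h0 : 0 ≤ f ∅)
    (h : ∀ T, T.Nonempty → avgErase f T + g T ≤ f T) :
    ∑ k ∈ Finset.range n, avgSubsets n k g ≤ f Finset.univ := by
  have key : ∀ k ≤ n, avgSubsets n k f + ∑ i ∈ Finset.range k, avgSubsets n i g ≤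
      f Finset.univ := by
    intro k hk
    induction k with
    | zero => simp [avgSubsets_zero]
    | succ k ih =>
      refine le_trans ?_ (ih (by omega))
      rw [Finset.sum_range_succ, ← avgSubsets_avgErase]
      have : avgSubsets n k (fun T => avgErase f T + g T) ≤ avgSubsets n k f :=
        avgSubsets_mono k fun T hT => h T (Finset.card_pos.1 (by omega))
      rw [avgSubsets_add] at this
      linarith
  have hn := key n le_rfl
  have : avgSubsets n n (fun _ => 0) ≤ avgSubsets n n f := by
    refine avgSubsets_mono n fun T hT => ?_
    rw [Finset.card_eq_zero.1 (by omega : T.card = 0)]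
    exact h0
  have hz := avgSubsets_mul_left (n := n) n 0 fun _ => 0
  simp only [zero_mul] at hz
  linarith

/-- The probability that a random subset contains `U`. -/
def containProb (n k : ℕ) (U : Finset (Fin n)) : ℝ :=
  avgSubsets n k fun T => if U ⊆ T then 1 else 0

theorem containProb_succ {k : ℕ} (hk : k < n) (U : Finset (Fin n)) :
    containProb n (k + 1) U = (1 - U.card / ((n : ℝ) - k)) * containProb n k U := by
  have hpos : (0 : ℝ) < (n : ℝ) - k := sub_pos.2 (by exact_mod_cast hk)
  rw [containProb, containProb, ← avgSubsets_avgErase, ← avgSubsets_mul_left]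
  refine avgSubsets_congr k fun T hT => ?_
  have hTc : (T.card : ℝ) = n - k := by
    rw [eq_sub_iff_add_eq]
    exact_mod_cast hT
  by_cases hU : U ⊆ T
  · have h1 : ∀ j ∈ T, (if U ⊆ T.erase j then (1 : ℝ) else 0) = if j ∈ T \ U then 1 else 0 := by
      intro j hj
      refine if_congr ?_ rfl rfl
      rw [Finset.subset_erase, Finset.mem_sdiff]
      tauto
    rw [avgErase, Finset.sum_congr rfl h1, if_pos hU, ← Finset.sum_filter, Finset.sum_const,
      Finset.filter_mem_eq_inter, Finset.inter_eq_right.2 Finset.sdiff_subset,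
      nsmul_one, Finset.cast_card_sdiff hU, hTc]
    field_simp
  · rw [avgErase, if_neg hU, mul_zero, Finset.sum_eq_zero, zero_div]
    intro j _
    exact if_neg fun h => hU (h.trans (Finset.erase_subset j T))

theorem containProb_nonneg (k : ℕ) (U : Finset (Fin n)) : 0 ≤ containProb n k U := by
  have hz := avgSubsets_mul_left (n := n) k 0 fun _ => 0
  simp only [zero_mul] at hz
  rw [← hz]
  exact avgSubsets_mono k fun T _ => by split_ifs <;> simp

theorem containProb_singleton {k : ℕ} (hk : k < n) (j : Fin n) :
    containProb n k {j} = ((n : ℝ) - k) / n := by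
  have hn : (n : ℝ) ≠ 0 := by
    have : 0 < n := by omega
    exact_mod_cast this.ne'
  induction k with
  | zero => simp [containProb, avgSubsets_zero, hn]
  | succ k ih =>
    have hpos : (0 : ℝ) < (n : ℝ) - k := sub_pos.2 (by exact_mod_cast (by omega : k < n))
    rw [containProb_succ (by omega), ih (by omega), Finset.card_singleton]
    push_cast
    field_simp
    ring

/-- The events that single elements belong to a random subset are negatively correlated. -/
theorem containProb_le {k : ℕ} (hk : k < n) (U : Finset (Fin n)) :
    containProb n k U ≤ (((n : ℝ) - k) / n) ^ U.card := by
  have hn : (n : ℝ) ≠ 0 := by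
    have : 0 < n := by omega
    exact_mod_cast this.ne'
  induction k with
  | zero => simp [containProb, avgSubsets_zero, hn]
  | succ k ih =>
    have hpos : (1 : ℝ) < (n : ℝ) - k := by
      rw [lt_sub_iff_add_lt]
      exact_mod_cast (by omega : 1 + k < n)
    have hpos' : (0 : ℝ) < (n : ℝ) - k := by linarith
    have hb : 1 - U.card / ((n : ℝ) - k) ≤ (1 - 1 / ((n : ℝ) - k)) ^ U.card := by
      have h2 : (-2 : ℝ) ≤ -(1 / ((n : ℝ) - k)) := by
        have := (div_le_one hpos').2 hpos.le
        linarith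
      have := one_add_mul_le_pow h2 U.card
      calc 1 - U.card / ((n : ℝ) - k) = 1 + U.card * -(1 / ((n : ℝ) - k)) := by ring
        _ ≤ _ := this
        _ = _ := by ring
    have hq : (((n : ℝ) - (k + 1 : ℕ)) / n) = (1 - 1 / ((n : ℝ) - k)) * (((n : ℝ) - k) / n) := by
      push_cast
      field_simp
      ring
    rw [containProb_succ (by omega), hq, mul_pow]
    refine (mul_le_mul_of_nonneg_right hb (containProb_nonneg k U)).trans ?_
    refine mul_le_mul_of_nonneg_left (ih (by omega)) (pow_nonneg ?_ _)
    have := (div_le_one hpos').2 hpos.le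
    linarith

/-- The moment generating function of a sum over a random subset that contains `j` is at most
that of a sum over independent choices. -/
theorem avgSubsets_prod_le {k : ℕ} (hk : k < n) (j : Fin n) {z : Fin n → ℝ} (hz : ∀ i, 0 ≤ z i) :
    avgSubsets n k (fun T => if j ∈ T then ∏ i ∈ T, (1 + z i) else 0) ≤
      ((n : ℝ) - k) / n * ((1 + z j) * ∏ i, (1 + ((n : ℝ) - k) / n * z i)) := by
  set q : ℝ := ((n : ℝ) - k) / n with hq
  have hq0 : 0 ≤ q := div_nonneg (sub_nonneg.2 (by exact_mod_cast hk.le)) (Nat.cast_nonneg n)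
  have h1 : ∀ T : Finset (Fin n), (if j ∈ T then ∏ i ∈ T, (1 + z i) else 0) =
      (1 + z j) * ∑ U ∈ (Finset.univ.erase j).powerset,
        (∏ i ∈ U, z i) * if insert j U ⊆ T then 1 else 0 := by
    intro T
    by_cases hj : j ∈ T
    · rw [if_pos hj, ← Finset.mul_prod_erase T _ hj, Finset.prod_one_add]
      congr 1
      simp only [Finset.insert_subset_iff, hj, true_and, mul_ite, mul_one, mul_zero]
      rw [← Finset.sum_filter]
      refine Finset.sum_congr ?_ fun _ _ => rfl
      ext U
      simp only [Finset.mem_powerset, Finset.mem_filter, Finset.subset_erase]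
      simp [and_comm]
    · simp [hj, Finset.insert_subset_iff]
  simp only [h1, avgSubsets_mul_left, avgSubsets_sum]
  rw [← mul_assoc, mul_comm q, mul_assoc]
  refine mul_le_mul_of_nonneg_left ?_ (by linarith [hz j])
  calc ∑ U ∈ (Finset.univ.erase j).powerset, (∏ i ∈ U, z i) * containProb n k (insert j U)
      ≤ ∑ U ∈ (Finset.univ.erase j).powerset, q * ∏ i ∈ U, (q * z i) := by
        refine Finset.sum_le_sum fun U hU => ?_
        have hjU : j ∉ U := fun h => by simpa using Finset.mem_powerset.1 hU h
        have := containProb_le hk (insert j U)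
        rw [Finset.card_insert_of_notMem hjU, ← hq] at this
        rw [Finset.prod_mul_distrib, Finset.prod_const]
        refine (mul_le_mul_of_nonneg_left this (Finset.prod_nonneg fun i _ => hz i)).trans
          (le_of_eq ?_)
        ring
    _ = q * ∏ i ∈ Finset.univ.erase j, (1 + q * z i) := by
        rw [← Finset.mul_sum, Finset.prod_one_add]
    _ ≤ q * ∏ i, (1 + q * z i) := by
        refine mul_le_mul_of_nonneg_left ?_ hq0
        have h2 : ∀ i, 1 ≤ 1 + q * z i := fun i => by
          have := mul_nonneg hq0 (hz i)
          linarith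
        rw [← Finset.mul_prod_erase Finset.univ _ (Finset.mem_univ j)]
        exact le_mul_of_one_le_left (Finset.prod_nonneg fun i _ => by linarith [h2 i]) (h2 j)

/-! ### Exponential moments of the normalized loads -/

/-- The load of resource `i` in units in which its capacity is `β`. -/
def load (I : Instance m n K) (β : ℝ) (x : Fin n → Fin K → ℝ) (i : Fin m) : ℝ :=
  β / I.cap i * usage I x i

/-- Capacities are positive, and in units in which all of them are `β` no demand exceeds `1`. -/
structure HasCapacityRatio (I : Instance m n K) (β : ℝ) : Prop where
  pos : 0 < β
  cap_pos : ∀ i, 0 < I.cap i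
  mul_demand_le : ∀ i j k, β * I.demand i j k ≤ I.cap i

theorem load_add (β : ℝ) (x y : Fin n → Fin K → ℝ) (i : Fin m) :
    load I β (x + y) i = load I β x i + load I β y i := by
  rw [load, usage_add, mul_add, load, load]

theorem load_eq_sum (β : ℝ) (x : Fin n → Fin K → ℝ) (i : Fin m) :
    load I β x i = ∑ j, ∑ k, β / I.cap i * I.demand i j k * x j k := by
  simp only [load, usage, Finset.mul_sum, mul_assoc]

theorem load_allocation (β : ℝ) (i : Fin m) (j : Fin n) (o : Option (Fin K)) :
    load I β (allocation j o) i = o.elim 0 fun k => β / I.cap i * I.demand i j k := by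
  rw [load_eq_sum]
  exact sum_mul_allocation (fun j k => β / I.cap i * I.demand i j k) j o

namespace HasCapacityRatio

variable {β : ℝ}

theorem weight_nonneg (h : HasCapacityRatio I β) (i : Fin m) (j : Fin n) (k : Fin K) :
    0 ≤ β / I.cap i * I.demand i j k :=
  mul_nonneg (div_nonneg h.pos.le (h.cap_pos i).le) (I.demand_nonneg i j k)

theorem weight_le_one (h : HasCapacityRatio I β) (i : Fin m) (j : Fin n) (k : Fin K) :
    β / I.cap i * I.demand i j k ≤ 1 := by
  rw [div_mul_eq_mul_div, div_le_one (h.cap_pos i)]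
  exact h.mul_demand_le i j k

theorem load_le_iff (h : HasCapacityRatio I β) (x : Fin n → Fin K → ℝ) (i : Fin m) (f : ℝ) :
    load I β x i ≤ f * β ↔ usage I x i ≤ f * I.cap i := by
  rw [load, div_mul_eq_mul_div, div_le_iff₀ (h.cap_pos i),
    show f * β * I.cap i = β * (f * I.cap i) by ring]
  exact mul_le_mul_iff_right₀ h.pos

theorem load_allocation_mem (h : HasCapacityRatio I β) (i : Fin m) (j : Fin n) (o : Option (Fin K)) :
    0 ≤ load I β (allocation j o) i ∧ load I β (allocation j o) i ≤ 1 := by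
  rw [load_allocation]
  cases o with
  | none => simp
  | some k => exact ⟨h.weight_nonneg i j k, h.weight_le_one i j k⟩

theorem hasRoom_of_load_le (h : HasCapacityRatio I β) {y : Fin n → Fin K → ℝ}
    (hy : ∀ i, load I β y i ≤ β - 1) :
    HasRoom I y := by
  intro i j k
  have h1 := hy i
  have h2 := h.weight_le_one i j k
  have h3 : β / I.cap i * (usage I y i + I.demand i j k) ≤ β / I.cap i * I.cap i := by
    rw [mul_add, div_mul_cancel₀ _ (h.cap_pos i).ne']
    rw [load] at h1
    linarith
  exact le_of_mul_le_mul_left h3 (div_pos h.pos (h.cap_pos i))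

end HasCapacityRatio

theorem exp_mul_le {θ u : ℝ} (h0 : 0 ≤ u) (h1 : u ≤ 1) :
    Real.exp (θ * u) ≤ 1 + (Real.exp θ - 1) * u := by
  have := convexOn_exp.2 (Set.mem_univ 0) (Set.mem_univ θ) (sub_nonneg.2 h1) h0 (by ring)
  simp only [smul_eq_mul, mul_zero, zero_add, Real.exp_zero, mul_one] at this
  rw [mul_comm θ u]
  linarith

theorem exp_sub_one_le {θ : ℝ} (h0 : 0 ≤ θ) (h1 : θ ≤ 1) : Real.exp θ - 1 ≤ θ + θ ^ 2 := by
  have := Real.abs_exp_sub_one_sub_id_le (x := θ) (by rwa [abs_of_nonneg h0])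
  linarith [le_abs_self (Real.exp θ - 1 - θ)]

/-- Exponential moments of the load in the idealized process. The last request to arrive is uniform
in `T`, and independent of the LP solution for `T`, so its expected load is a `1 / |T|` fraction of
the load of that solution. -/
theorem avgOrders_exp_load_le {β : ℝ} (h : HasCapacityRatio I β) (A : Solver I) {θ : ℝ}
    (hθ : 0 ≤ θ) (i : Fin m) (T : Finset (Fin n)) :
    avgOrders T (fun r => idealExp A r fun y => Real.exp (θ * load I β y i)) ≤
      Real.exp ((Real.exp θ - 1) * (β * (T.card / n))) := by
  have he : 0 ≤ Real.exp θ - 1 := sub_nonneg.2 (Real.one_le_exp hθ)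
  induction T using Finset.strongInduction with
  | H T ih =>
    rcases T.eq_empty_or_nonempty with rfl | hT
    · simp [avgOrders_empty, idealExp, load, usage]
    have hc : (0 : ℝ) < T.card := by exact_mod_cast hT.card_pos
    set G : ℝ := Real.exp ((Real.exp θ - 1) * (β * ((T.card - 1) / n))) with hG
    set x := A.sol T ∅ with hx
    -- The conditional exponential moment of the load caused by `j`.
    set c : Fin n → ℝ := fun j =>
      ∑ o, roundProb (x j) o * Real.exp (θ * load I β (allocation j o) i) with hc'
    have hc0 : ∀ j, 0 ≤ c j := fun j => Finset.sum_nonneg fun o _ =>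
      mul_nonneg (roundProb_nonneg A T ∅ j o) (Real.exp_nonneg _)
    have hcle : ∀ j, c j ≤ 1 + (Real.exp θ - 1) * ∑ k, β / I.cap i * I.demand i j k * x j k := by
      intro j
      calc c j ≤ ∑ o, roundProb (x j) o *
            (1 + (Real.exp θ - 1) * o.elim 0 fun k => β / I.cap i * I.demand i j k) := by
            refine Finset.sum_le_sum fun o _ =>
              mul_le_mul_of_nonneg_left ?_ (roundProb_nonneg A T ∅ j o)
            rw [← load_allocation]
            exact exp_mul_le (h.load_allocation_mem i j o).1 (h.load_allocation_mem i j o).2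
        _ = _ := by
            simp only [mul_add, mul_one, Finset.sum_add_distrib, sum_roundProb,
              mul_left_comm _ (Real.exp θ - 1), ← Finset.mul_sum, sum_roundProb_mul_elim]
    have hstep : ∀ j ∈ T, avgOrders (T.erase j) (fun r => idealExp A (j :: r) fun y =>
        Real.exp (θ * load I β y i)) ≤ c j * G := by
      intro j hj
      have h1 : avgOrders (T.erase j) (fun r => idealExp A (j :: r) fun y =>
          Real.exp (θ * load I β y i)) ≤ avgOrders (T.erase j) (fun r => c j *
            idealExp A r fun y => Real.exp (θ * load I β y i)) := by
        refine avgOrders_mono fun r hr => le_of_eq ?_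
        have hr' : insert j r.toFinset = T := by
          rw [(mem_orders_iff.1 hr).2, Finset.insert_erase hj]
        rw [idealExp, hr', ← idealExp_mul_left]
        congr 1
        funext y
        rw [hc', Finset.sum_mul]
        refine Finset.sum_congr rfl fun o _ => ?_
        rw [load_add, mul_add, Real.exp_add]
        ring
      rw [avgOrders_mul_left] at h1
      refine h1.trans (mul_le_mul_of_nonneg_left ?_ (hc0 j))
      have := ih _ (Finset.erase_ssubset hj)
      rwa [Finset.cast_card_erase_of_mem hj] at this
    have hload : ∑ j ∈ T, ∑ k, β / I.cap i * I.demand i j k * x j k ≤ T.card / n * β := by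
      have h1 := (h.load_le_iff x i _).2 ((A.mem T ∅).2.1 i)
      rw [load_eq_sum] at h1
      refine le_trans (Finset.sum_le_sum_of_subset_of_nonneg (Finset.subset_univ T)
        fun j _ _ => Finset.sum_nonneg fun k _ => ?_) h1
      exact mul_nonneg (h.weight_nonneg i j k) ((A.mem T ∅).1 j k)
    have hsum : (∑ j ∈ T, c j) / T.card ≤ Real.exp ((Real.exp θ - 1) * (β / n)) := by
      have h1 : ∑ j ∈ T, c j ≤ T.card + (Real.exp θ - 1) * (T.card / n * β) := by
        refine (Finset.sum_le_sum fun j _ => hcle j).trans ?_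
        rw [Finset.sum_add_distrib, ← Finset.mul_sum, Finset.sum_const, nsmul_one]
        gcongr
      refine le_trans ?_ (Real.add_one_le_exp _)
      rw [div_le_iff₀ hc]
      refine h1.trans (le_of_eq ?_)
      ring
    rw [avgOrders_eq hT]
    calc _ ≤ (∑ j ∈ T, c j * G) / T.card := by gcongr with j hj; exact hstep j hj
      _ = (∑ j ∈ T, c j) / T.card * G := by rw [← Finset.sum_mul]; ring
      _ ≤ Real.exp ((Real.exp θ - 1) * (β / n)) * G := by gcongr
      _ = _ := by
        rw [hG, ← Real.exp_add]
        congr 1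
        ring

/-! ### The mechanism rarely runs out of capacity -/

theorem one_le_log' (k : ℕ) : 1 ≤ log' k := le_max_right _ _

theorem cast_le_exp_log' (k : ℕ) : (k : ℝ) ≤ Real.exp (log' k) := by
  rcases Nat.eq_zero_or_pos k with rfl | hk
  · simpa using Real.exp_nonneg _
  have hk' : (0 : ℝ) < k := by exact_mod_cast hk
  rw [← Real.log_le_iff_le_exp hk']
  have h2 : Real.log 2 ≤ 1 := by linarith [Real.log_two_lt_d9]
  have h3 : Real.log k = Real.logb 2 k * Real.log 2 := by
    rw [Real.logb, div_mul_cancel₀]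
    exact (Real.log_pos one_lt_two).ne'
  rw [h3]
  have h4 : 0 ≤ log' k := zero_le_one.trans (one_le_log' k)
  calc Real.logb 2 k * Real.log 2 ≤ log' k * Real.log 2 :=
        mul_le_mul_of_nonneg_right (le_max_left _ _) (Real.log_nonneg one_le_two)
    _ ≤ log' k := mul_le_of_le_one_right h4 h2

theorem roomProb_nonneg (A : Solver I) (r : List (Fin n)) : 0 ≤ roomProb A r := by
  classical
  rw [← idealExp_const A r 0, roomProb]
  exact idealExp_mono A r fun y => by split_ifs <;> simp

/-- Whatever set `T` of requests has arrived, the probability that the idealized process has run out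
of room decays exponentially in the fraction of requests still to come, at rate `1 / (3 * δ)` with
`δ = √(log' m / β)`. -/
theorem HasCapacityRatio.avgOrders_roomProb {β : ℝ} (h : HasCapacityRatio I β) (A : Solver I)
    (hδ : Real.sqrt (log' m / β) ≤ 1) (T : Finset (Fin n)) :
    1 - Real.exp (1 - (1 - T.card / n) / (3 * Real.sqrt (log' m / β))) ≤
      avgOrders T (roomProb A) := by
  classical
  set L := log' m with hL
  have hL1 : 1 ≤ L := one_le_log' m
  set δ := Real.sqrt (L / β) with hδ'
  have hLβ : 0 < L / β := div_pos (by linarith) h.pos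
  have hδ0 : 0 < δ := Real.sqrt_pos.2 hLβ
  have hδ2 : δ ^ 2 * β = L := by
    rw [hδ', Real.sq_sqrt hLβ.le, div_mul_cancel₀ _ h.pos.ne']
  set s : ℝ := 1 - T.card / n with hs
  have hs0 : 0 ≤ s := by
    rw [hs, sub_nonneg]
    refine div_le_one_of_le₀ ?_ (Nat.cast_nonneg n)
    exact_mod_cast (Finset.card_le_univ T).trans_eq (Fintype.card_fin n)
  have h0 : 0 ≤ avgOrders T (roomProb A) := by
    rw [← avgOrders_const T 0]
    exact avgOrders_mono fun r _ => roomProb_nonneg A r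
  -- The Chernoff bound, with the exponential parameter `δ`.
  have hmain : 1 - Real.exp (3 * L - δ * β * s) ≤ avgOrders T (roomProb A) := by
    have h1 : ∀ r, 1 + ∑ i, -Real.exp (-(δ * (β - 1))) *
        idealExp A r (fun y => Real.exp (δ * load I β y i)) ≤ roomProb A r := by
      intro r
      have h2 : 1 + ∑ i, -Real.exp (-(δ * (β - 1))) *
          idealExp A r (fun y => Real.exp (δ * load I β y i)) = idealExp A r fun y =>
            1 + ∑ i, -Real.exp (-(δ * (β - 1))) * Real.exp (δ * load I β y i) := by
        rw [idealExp_add, idealExp_const, idealExp_sum]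
        simp only [idealExp_mul_left]
      rw [h2, roomProb]
      refine idealExp_mono A r fun y => ?_
      by_cases hy : ∀ i, load I β y i ≤ β - 1
      · rw [if_pos (h.hasRoom_of_load_le hy)]
        simp only [neg_mul, Finset.sum_neg_distrib]
        have : 0 ≤ ∑ i, Real.exp (-(δ * (β - 1))) * Real.exp (δ * load I β y i) :=
          Finset.sum_nonneg fun i _ => by positivity
        linarith
      · push Not at hy
        obtain ⟨i, hi⟩ := hy
        have h2 : 1 ≤ ∑ i, Real.exp (-(δ * (β - 1))) * Real.exp (δ * load I β y i) := by
          refine le_trans ?_ (Finset.single_le_sum (fun i _ => by positivity)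
            (Finset.mem_univ i))
          rw [← Real.exp_add]
          refine Real.one_le_exp ?_
          have := mul_le_mul_of_nonneg_left hi.le hδ0.le
          linarith
        simp only [neg_mul, Finset.sum_neg_distrib]
        split_ifs <;> linarith
    have h2 := avgOrders_mono (T := T) fun r _ => h1 r
    rw [avgOrders_add, avgOrders_const, avgOrders_sum] at h2
    simp only [avgOrders_mul_left] at h2
    refine le_trans ?_ h2
    rw [sub_eq_add_neg]
    gcongr
    simp only [neg_mul, Finset.sum_neg_distrib, neg_le_neg_iff]
    calc _ ≤ ∑ i : Fin m, Real.exp (2 * L - δ * β * s) := by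
          refine Finset.sum_le_sum fun i _ => ?_
          refine (mul_le_mul_of_nonneg_left (avgOrders_exp_load_le h A hδ0.le i T)
            (Real.exp_nonneg _)).trans ?_
          rw [← Real.exp_add, Real.exp_le_exp]
          have ht : (T.card / n : ℝ) = 1 - s := by rw [hs]; ring
          have ht0 : 0 ≤ 1 - s := ht ▸ div_nonneg (Nat.cast_nonneg _) (Nat.cast_nonneg _)
          rw [ht]
          have h3 := mul_le_mul_of_nonneg_right (exp_sub_one_le hδ0.le hδ)
            (mul_nonneg h.pos.le ht0)
          have h4 : 0 ≤ δ ^ 2 * β * s := by rw [hδ2]; exact mul_nonneg (by linarith) hs0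
          calc _ ≤ -(δ * (β - 1)) + (δ + δ ^ 2) * (β * (1 - s)) := by gcongr
            _ = δ + δ ^ 2 * β - δ ^ 2 * β * s - δ * β * s := by ring
            _ ≤ _ := by linarith
      _ = m * Real.exp (2 * L - δ * β * s) := by
          rw [Finset.sum_const, Finset.card_univ, Fintype.card_fin, nsmul_eq_mul]
      _ ≤ Real.exp L * Real.exp (2 * L - δ * β * s) := by
          gcongr
          exact cast_le_exp_log' m
      _ = _ := by
          rw [← Real.exp_add]
          congr 1
          ring
  -- As probabilities are at most `1`, the exponent may be divided by `3 * L`, which removes the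
  -- factor `m` from the bound.
  have hexp : 1 - s / (3 * δ) = (3 * L - δ * β * s) / (3 * L) := by
    rw [← hδ2]
    have := h.pos
    field_simp
  rw [hexp]
  rcases le_total (3 * L - δ * β * s) 0 with hneg | hpos
  · refine le_trans ?_ hmain
    gcongr
    rw [le_div_iff₀ (by linarith)]
    nlinarith
  · refine le_trans ?_ h0
    rw [sub_nonpos]
    exact Real.one_le_exp (div_nonneg hpos (by linarith))

/-! ### The LP value of a random sample -/

theorem profitWithout_empty (I : Instance m n K) : profitWithout I ∅ = I.profit := by
  funext j k
  simp [profitWithout]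

theorem value_sol_nonneg (A : Solver I) (S : Finset (Fin n)) :
    0 ≤ value I.profit (A.sol S ∅) :=
  value_nonneg I.profit_nonneg (A.mem S ∅).1

/-- Restricting `x` to `S` and scaling it by `1 / Q` gives a feasible solution; `1 / Q` is
bounded below by its tangent `2 - Q`. -/
theorem le_value_sol {β : ℝ} (h : HasCapacityRatio I β) (A : Solver I)
    {x : Fin n → Fin K → ℝ} (hx : x ∈ polytope I 1 Finset.univ) {S : Finset (Fin n)} {Q : ℝ}
    (hQ : 1 ≤ Q) (hload : ∀ i, ∑ j ∈ S, ∑ k, β / I.cap i * I.demand i j k * x j k ≤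
      Q * (S.card / n * β)) :
    (2 - Q) * ∑ j ∈ S, ∑ k, I.profit j k * x j k ≤ value I.profit (A.sol S ∅) := by
  classical
  have hQ0 : 0 < Q := by linarith
  set x' : Fin n → Fin K → ℝ := fun j k => if j ∈ S then Q⁻¹ * x j k else 0 with hx'
  have hsum : ∀ w : Fin n → Fin K → ℝ, ∑ j, ∑ k, w j k * x' j k =
      Q⁻¹ * ∑ j ∈ S, ∑ k, w j k * x j k := by
    intro w
    rw [Finset.mul_sum, ← Finset.sum_filter_add_sum_filter_not Finset.univ (· ∈ S),
      Finset.filter_mem_eq_inter, Finset.univ_inter]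
    rw [Finset.sum_eq_zero (s := Finset.univ.filter (· ∉ S)), add_zero]
    · refine Finset.sum_congr rfl fun j hj => ?_
      rw [Finset.mul_sum]
      refine Finset.sum_congr rfl fun k _ => ?_
      simp only [hx', if_pos hj]
      ring
    · intro j hj
      have : j ∉ S := (Finset.mem_filter.1 hj).2
      simp [hx', this]
  have hmem : x' ∈ scaledPolytope I S := by
    refine ⟨fun j k => ?_, fun i => ?_, fun j hj => ?_, fun j hj k => ?_⟩
    · simp only [hx']
      split_ifs
      exacts [mul_nonneg (inv_nonneg.2 hQ0.le) (hx.1 j k), le_rfl]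
    · rw [← h.load_le_iff, load_eq_sum, hsum, inv_mul_le_iff₀ hQ0]
      exact hload i
    · simp only [hx', if_pos hj, ← Finset.mul_sum]
      refine mul_le_one₀ (inv_le_one_of_one_le₀ hQ) ?_ (hx.2.2.1 j (Finset.mem_univ j))
      exact Finset.sum_nonneg fun k _ => hx.1 j k
    · simp [hx', hj]
  have hopt := A.optimal S ∅ x' hmem
  rw [profitWithout_empty] at hopt
  refine le_trans ?_ hopt
  rw [value, hsum]
  refine mul_le_mul_of_nonneg_right ?_ (Finset.sum_nonneg fun j _ => Finset.sum_nonneg fun k _ =>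
    mul_nonneg (I.profit_nonneg j k) (hx.1 j k))
  have : 0 ≤ (Q - 1) ^ 2 / Q := by positivity
  have h2 : Q⁻¹ - (2 - Q) = (Q - 1) ^ 2 / Q := by
    field_simp
    ring
  linarith

/-- The LP optimum of a random sample containing a fraction `q` of the requests, with capacities
scaled by `q`, is on average a `q * (1 - 5 * √(log' m / (q * β)))` fraction of the full optimum. The
candidate solution is `x` restricted to the sample `T` and divided by a smooth maximum `Q T` of the
relative loads, whose expectation is controlled by exponential moments. -/
theorem avgSubsets_value_sol {β : ℝ} (h : HasCapacityRatio I β) (A : Solver I)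
    {x : Fin n → Fin K → ℝ} (hx : x ∈ polytope I 1 Finset.univ) {k : ℕ} (hk : k < n) :
    ((n : ℝ) - k) / n * ((1 - 5 * Real.sqrt (log' m / (((n : ℝ) - k) / n * β))) *
        value I.profit x) ≤
      avgSubsets n k fun T => value I.profit (A.sol T ∅) := by
  set L := log' m with hL
  have hL1 : 1 ≤ L := one_le_log' m
  have hn : (0 : ℝ) < n := by exact_mod_cast (Nat.zero_le k).trans_lt hk
  set q : ℝ := ((n : ℝ) - k) / n with hq
  have hq0 : 0 < q := div_pos (sub_pos.2 (by exact_mod_cast hk)) hn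
  set μ : ℝ := q * β with hμ
  have hμ0 : 0 < μ := mul_pos hq0 h.pos
  set θ := Real.sqrt (L / μ) with hθ
  have hLμ : 0 < L / μ := div_pos (by linarith) hμ0
  have hθ0 : 0 < θ := Real.sqrt_pos.2 hLμ
  have hθ2 : θ * (θ * μ) = L := by
    rw [← mul_assoc, hθ, Real.mul_self_sqrt hLμ.le, div_mul_cancel₀ _ hμ0.ne']
  have hval : 0 ≤ value I.profit x := value_nonneg I.profit_nonneg hx.1
  rcases lt_or_ge 1 θ with hθ1 | hθ1
  · have h0 : 0 ≤ avgSubsets n k fun T => value I.profit (A.sol T ∅) := by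
      have hz := avgSubsets_mul_left (n := n) k 0 fun _ => 0
      simp only [zero_mul] at hz
      rw [← hz]
      exact avgSubsets_mono k fun T _ => value_sol_nonneg A T
    refine le_trans ?_ h0
    exact mul_nonpos_of_nonneg_of_nonpos hq0.le
      (mul_nonpos_of_nonpos_of_nonneg (by linarith) hval)
  set lam := θ * μ with hlam
  have hlam0 : 0 < lam := mul_pos hθ0 hμ0
  -- `u i j` is the normalized load that `x` puts on resource `i` by serving request `j`.
  set u : Fin m → Fin n → ℝ := fun i j => ∑ k, β / I.cap i * I.demand i j k * x j k with hu
  have hu0 : ∀ i j, 0 ≤ u i j := fun i j => Finset.sum_nonneg fun k _ =>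
    mul_nonneg (h.weight_nonneg i j k) (hx.1 j k)
  have hu1 : ∀ i j, u i j ≤ 1 := fun i j =>
    (Finset.sum_le_sum fun k _ => mul_le_of_le_one_left (hx.1 j k) (h.weight_le_one i j k)).trans
      (hx.2.2.1 j (Finset.mem_univ j))
  have husum : ∀ i, ∑ j, u i j ≤ β := fun i => by
    have := (h.load_le_iff x i 1).2 (hx.2.1 i)
    rwa [load_eq_sum, one_mul] at this
  set v : Fin n → ℝ := fun j => ∑ k, I.profit j k * x j k with hv
  have hv0 : ∀ j, 0 ≤ v j := fun j => Finset.sum_nonneg fun k _ =>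
    mul_nonneg (I.profit_nonneg j k) (hx.1 j k)
  -- `Q T` is a smooth upper bound on `1` and on all relative loads in the sample `T`.
  set Q : Finset (Fin n) → ℝ := fun T =>
    1 + 4 * θ + ∑ i, lam⁻¹ * Real.exp (-(lam * (1 + 4 * θ))) * Real.exp (θ * ∑ j ∈ T, u i j)
    with hQ
  have hQ1 : ∀ T, 1 ≤ Q T := fun T => by
    have : 0 ≤ ∑ i, lam⁻¹ * Real.exp (-(lam * (1 + 4 * θ))) *
      Real.exp (θ * ∑ j ∈ T, u i j) := Finset.sum_nonneg fun i _ => by positivity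
    simp only [hQ]
    linarith
  have hQload : ∀ T i, ∑ j ∈ T, u i j ≤ Q T * μ := by
    intro T i
    have h1 : lam⁻¹ * Real.exp (-(lam * (1 + 4 * θ))) * Real.exp (θ * ∑ j ∈ T, u i j) ≤
        ∑ i, lam⁻¹ * Real.exp (-(lam * (1 + 4 * θ))) * Real.exp (θ * ∑ j ∈ T, u i j) :=
      Finset.single_le_sum (f := fun i => lam⁻¹ * Real.exp (-(lam * (1 + 4 * θ))) *
        Real.exp (θ * ∑ j ∈ T, u i j)) (fun i _ => by positivity) (Finset.mem_univ i)
    have h2 : θ * ∑ j ∈ T, u i j - lam * (1 + 4 * θ) ≤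
        Real.exp (-(lam * (1 + 4 * θ))) * Real.exp (θ * ∑ j ∈ T, u i j) := by
      rw [← Real.exp_add]
      linarith [Real.add_one_le_exp (-(lam * (1 + 4 * θ)) + θ * ∑ j ∈ T, u i j)]
    have h3 : lam⁻¹ * (θ * ∑ j ∈ T, u i j - lam * (1 + 4 * θ)) + (1 + 4 * θ) ≤ Q T := by
      have := mul_le_mul_of_nonneg_left h2 (inv_nonneg.2 hlam0.le)
      rw [← mul_assoc] at this
      simp only [hQ]
      linarith
    have h4 : lam⁻¹ * (θ * ∑ j ∈ T, u i j - lam * (1 + 4 * θ)) + (1 + 4 * θ) =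
        (∑ j ∈ T, u i j) / μ := by
      rw [hlam]
      field_simp
      ring
    rwa [h4, div_le_iff₀ hμ0] at h3
  -- Lower bound on the LP value of a sample, as a sum over the requests `j` in it.
  set c : ℝ := lam⁻¹ * Real.exp (-(lam * (1 + 4 * θ))) with hcdef
  have hc0 : 0 ≤ c := by positivity
  set F : Fin m → Fin n → Finset (Fin n) → ℝ := fun i j T =>
    if j ∈ T then ∏ j' ∈ T, (1 + (Real.exp (θ * u i j') - 1)) else 0 with hF
  have hlow : ∀ T : Finset (Fin n), T.card + k = n →
      (∑ j, v j * ((1 - 4 * θ) * (if {j} ⊆ T then 1 else 0) + ∑ i, -c * F i j T)) ≤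
        value I.profit (A.sol T ∅) := by
    intro T hT
    have hTq : (T.card : ℝ) / n = q := by
      rw [hq, eq_sub_of_add_eq (by exact_mod_cast hT : (T.card : ℝ) + k = n)]
    refine le_trans (le_of_eq ?_) (le_value_sol h A hx (hQ1 T) fun i => ?_)
    · have h1 : ∀ j, v j * ((1 - 4 * θ) * (if {j} ⊆ T then 1 else 0) + ∑ i, -c * F i j T) =
          if j ∈ T then (2 - Q T) * v j else 0 := by
        intro j
        by_cases hj : j ∈ T
        · simp only [Finset.singleton_subset_iff, hj, if_true, hF, hQ, add_sub_cancel,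
            ← Real.exp_sum, ← Finset.mul_sum, neg_mul, Finset.sum_neg_distrib]
          ring
        · simp [hj, hF]
      rw [Finset.sum_congr rfl fun j _ => h1 j, Finset.sum_ite_mem, Finset.univ_inter,
        Finset.mul_sum]
    · rw [hTq]
      exact hQload T i
  refine le_trans ?_ (avgSubsets_mono k hlow)
  have hFavg : ∀ i j, avgSubsets n k (F i j) ≤ q * Real.exp (θ + (lam + L)) := by
    intro i j
    have hz : ∀ j, 0 ≤ Real.exp (θ * u i j) - 1 := fun j =>
      sub_nonneg.2 (Real.one_le_exp (mul_nonneg hθ0.le (hu0 i j)))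
    refine (avgSubsets_prod_le hk j hz).trans ?_
    rw [← hq, Real.exp_add]
    refine mul_le_mul_of_nonneg_left (mul_le_mul ?_ ?_ ?_ (Real.exp_nonneg _)) hq0.le
    · rw [add_sub_cancel, Real.exp_le_exp]
      exact mul_le_of_le_one_right hθ0.le (hu1 i j)
    · calc ∏ j', (1 + q * (Real.exp (θ * u i j') - 1))
          ≤ ∏ j', Real.exp (q * ((θ + θ ^ 2) * u i j')) := by
            refine Finset.prod_le_prod (fun j' _ => ?_) fun j' _ => ?_
            · have := mul_nonneg hq0.le (hz j')
              linarith
            · have h1 := exp_mul_le (θ := θ) (hu0 i j') (hu1 i j')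
              have h2 := mul_le_mul_of_nonneg_right (exp_sub_one_le hθ0.le hθ1) (hu0 i j')
              have h3 : q * (Real.exp (θ * u i j') - 1) ≤ q * ((θ + θ ^ 2) * u i j') := by
                gcongr
                linarith
              linarith [Real.add_one_le_exp (q * ((θ + θ ^ 2) * u i j'))]
        _ = Real.exp (q * (θ + θ ^ 2) * ∑ j', u i j') := by
            rw [← Real.exp_sum, Finset.mul_sum]
            simp only [mul_assoc]
        _ ≤ Real.exp (lam + L) := by
            rw [Real.exp_le_exp]
            refine (mul_le_mul_of_nonneg_left (husum i) (by positivity)).trans (le_of_eq ?_)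
            rw [← hθ2, hlam, hμ]
            ring
    · exact Finset.prod_nonneg fun j' _ => by
        have := mul_nonneg hq0.le (hz j')
        linarith
  have herr : ∑ i : Fin m, c * (q * Real.exp (θ + (lam + L))) ≤ q * θ := by
    have h1 : ∑ i : Fin m, c * (q * Real.exp (θ + (lam + L))) =
        q * lam⁻¹ * (m * Real.exp (θ - 3 * L)) := by
      have h2 : Real.exp (θ - 3 * L) =
          Real.exp (-(lam * (1 + 4 * θ))) * Real.exp (θ + (lam + L)) := by
        rw [← Real.exp_add]
        congr 1
        linarith
      rw [h2, Finset.sum_const, Finset.card_univ, Fintype.card_fin, nsmul_eq_mul, hcdef]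
      ring
    have h3 : m * Real.exp (θ - 3 * L) ≤ 1 := by
      calc m * Real.exp (θ - 3 * L) ≤ Real.exp L * Real.exp (θ - 3 * L) := by
            gcongr
            exact cast_le_exp_log' m
        _ ≤ 1 := by
            rw [← Real.exp_add, Real.exp_le_one_iff]
            linarith
    have h4 : lam⁻¹ ≤ θ := by
      rw [inv_le_iff_one_le_mul₀ hlam0, hθ2]
      exact hL1
    rw [h1]
    calc q * lam⁻¹ * (m * Real.exp (θ - 3 * L)) ≤ q * lam⁻¹ :=
          mul_le_of_le_one_right (by positivity) h3
      _ ≤ q * θ := by gcongr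
  rw [avgSubsets_sum]
  have hvx : value I.profit x = ∑ j, v j := rfl
  rw [hvx, Finset.mul_sum, Finset.mul_sum]
  refine Finset.sum_le_sum fun j _ => ?_
  rw [avgSubsets_mul_left, avgSubsets_add, avgSubsets_mul_left, avgSubsets_sum]
  have hs := containProb_singleton hk j
  rw [containProb, ← hq] at hs
  rw [hs]
  simp only [avgSubsets_mul_left]
  have h5 : ∑ i, c * avgSubsets n k (F i j) ≤ q * θ := by
    refine le_trans (Finset.sum_le_sum fun i _ => ?_) herr
    exact mul_le_mul_of_nonneg_left (hFavg i j) hc0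
  simp only [neg_mul, Finset.sum_neg_distrib]
  calc q * ((1 - 5 * θ) * v j) = v j * ((1 - 4 * θ) * q - q * θ) := by ring
    _ ≤ _ := by
      refine mul_le_mul_of_nonneg_left ?_ (hv0 j)
      linarith

/-! ### Adding up the rounds -/

theorem mul_sum_exp_neg_le (a : ℝ) (N : ℕ) :
    a * ∑ k ∈ Finset.range N, Real.exp (-((k + 1) * a)) ≤ 1 - Real.exp (-(N * a)) := by
  induction N with
  | zero => simp
  | succ N ih =>
    have h1 : Real.exp (-(N * a)) = Real.exp (-((N + 1) * a)) * Real.exp a := by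
      rw [← Real.exp_add]
      congr 1
      ring
    have h2 := mul_le_mul_of_nonneg_left (Real.add_one_le_exp a)
      (Real.exp_nonneg (-((N + 1) * a)))
    rw [Finset.sum_range_succ, mul_add]
    push_cast
    linarith

theorem sum_inv_sqrt_le (N : ℕ) :
    ∑ k ∈ Finset.range N, (Real.sqrt (k + 1))⁻¹ ≤ 2 * Real.sqrt N := by
  induction N with
  | zero => simp
  | succ N ih =>
    rw [Finset.sum_range_succ]
    have hN : (0 : ℝ) ≤ N := Nat.cast_nonneg N
    have hpos : 0 < Real.sqrt ((N : ℝ) + 1) := Real.sqrt_pos.2 (by linarith)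
    have h1 := Real.sq_sqrt hN
    have h2 := Real.sq_sqrt (by linarith : (0 : ℝ) ≤ N + 1)
    have h3 : (Real.sqrt ((N : ℝ) + 1))⁻¹ ≤ 2 * Real.sqrt (N + 1) - 2 * Real.sqrt N := by
      rw [inv_le_iff_one_le_mul₀ hpos]
      nlinarith [sq_nonneg (Real.sqrt ((N : ℝ) + 1) - Real.sqrt N)]
    push_cast
    linarith

/-- With `ℓ` known requests, the current one is uniform among them, so that it contributes a `1 / ℓ`
fraction of the LP optimum of the sample, unless the mechanism has run out of room. Here the losses
from running out of room add up to at most `9 * δ`, those from sampling to at most `10 * δ`. -/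
theorem HasCapacityRatio.le_expectedWelfare {β : ℝ} (h : HasCapacityRatio I β) (A : Solver I)
    (hδ : Real.sqrt (log' m / β) ≤ 1) {x : Fin n → Fin K → ℝ}
    (hx : x ∈ polytope I 1 Finset.univ) :
    (1 - 19 * Real.sqrt (log' m / β)) * value I.profit x ≤ expectedWelfare A I.profit := by
  set L := log' m with hL
  have hL1 : 1 ≤ L := one_le_log' m
  set δ := Real.sqrt (L / β) with hδ'
  have hδ0 : 0 < δ := Real.sqrt_pos.2 (div_pos (by linarith) h.pos)
  set W := value I.profit x with hW
  have hW0 : 0 ≤ W := value_nonneg I.profit_nonneg hx.1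
  set f : Finset (Fin n) → ℝ := fun T =>
    avgOrders T fun r => expAfter A r fun s => value I.profit s.y with hf
  -- `ρ t` bounds the probability that some option does not fit after `t` rounds.
  set ρ : ℝ → ℝ := fun t => Real.exp (1 - (1 - t / n) / (3 * δ)) with hρ
  set g : Finset (Fin n) → ℝ := fun T =>
    max 0 (1 - ρ (T.card - 1)) / T.card * value I.profit (A.sol T ∅) with hg
  have hE : expectedWelfare A I.profit = f Finset.univ := by
    rw [expectedWelfare_eq,
      sum_perm_eq_avgOrders fun r => expAfter A r fun s => value I.profit s.y]
  have hstep : ∀ T : Finset (Fin n), T.Nonempty → avgErase f T + g T ≤ f T := by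
    intro T hT
    have hroom : ∀ j ∈ T, max 0 (1 - ρ (T.card - 1)) ≤ avgOrders (T.erase j) (roomProb A) := by
      intro j hj
      refine max_le ?_ ?_
      · rw [← avgOrders_const (T.erase j) 0]
        exact avgOrders_mono fun r _ => roomProb_nonneg A r
      · have := h.avgOrders_roomProb A hδ (T.erase j)
        rwa [Finset.cast_card_erase_of_mem hj] at this
    have hval : value I.profit (A.sol T ∅) = ∑ j ∈ T, gain A T j := by
      rw [value, ← Finset.sum_subset (Finset.subset_univ T)]
      · rfl
      · intro j _ hj
        exact Finset.sum_eq_zero fun k _ => by rw [(A.mem T ∅).2.2.2 j hj k, mul_zero]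
    have hgT : g T =
        (∑ j ∈ T, gain A T j * max 0 (1 - ρ (T.card - 1))) / T.card := by
      rw [← Finset.sum_mul, ← hval]
      simp only [hg]
      ring
    rw [hgT, avgErase, ← add_div, ← Finset.sum_add_distrib]
    simp only [hf]
    rw [avgOrders_eq hT]
    gcongr with j hj
    have h1 : avgOrders (T.erase j) (fun r =>
        (expAfter A r fun s => value I.profit s.y) + gain A T j * roomProb A r) ≤
        avgOrders (T.erase j) fun r => expAfter A (j :: r) fun s => value I.profit s.y := by
      refine avgOrders_mono fun r hr => ?_
      have hr' : insert j r.toFinset = T := by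
        rw [(mem_orders_iff.1 hr).2, Finset.insert_erase hj]
      rw [← hr']
      exact expAfter_value_cons A j r
    rw [avgOrders_add, avgOrders_mul_left] at h1
    refine le_trans ?_ h1
    gcongr
    exacts [gain_nonneg A T j, hroom j hj]
  have hf0 : 0 ≤ f ∅ := by
    simp [hf, avgOrders_empty, expAfter, State.init, value]
  rw [hE]
  refine le_trans ?_ (sum_avgSubsets_le hf0 hstep)
  rcases Nat.eq_zero_or_pos n with rfl | hn
  · simp [hW, value]
  have hn' : (0 : ℝ) < n := by exact_mod_cast hn
  -- The round in which `k` requests are still to come after the current one.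
  have hround : ∀ k ∈ Finset.range n,
      W / n * (1 - Real.exp 1 * Real.exp (-((k + 1) * (3 * δ * n)⁻¹)) -
        5 * δ * (Real.sqrt n * (Real.sqrt (n - k))⁻¹)) ≤ avgSubsets n k g := by
    intro k hk
    have hk : k < n := Finset.mem_range.1 hk
    have hk' : (0 : ℝ) < (n : ℝ) - k := sub_pos.2 (by exact_mod_cast hk)
    have h1 : avgSubsets n k g = max 0 (1 - ρ ((n : ℝ) - k - 1)) / ((n : ℝ) - k) *
        avgSubsets n k fun T => value I.profit (A.sol T ∅) := by
      rw [← avgSubsets_mul_left]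
      refine avgSubsets_congr k fun T hT => ?_
      simp only [hg, eq_sub_of_add_eq (by exact_mod_cast hT : (T.card : ℝ) + k = n)]
    have hρk : ρ ((n : ℝ) - k - 1) = Real.exp 1 * Real.exp (-((k + 1) * (3 * δ * n)⁻¹)) := by
      rw [← Real.exp_add]
      simp only [hρ]
      congr 1
      field_simp
      ring
    have hθ : Real.sqrt (L / (((n : ℝ) - k) / n * β)) =
        δ * (Real.sqrt n * (Real.sqrt (n - k))⁻¹) := by
      rw [hδ', ← Real.sqrt_inv, ← Real.sqrt_mul hn'.le,
        ← Real.sqrt_mul (div_nonneg (by linarith) h.pos.le)]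
      congr 1
      have := h.pos
      field_simp
    have h2 := avgSubsets_value_sol h A hx hk
    rw [← hL, hθ, ← hW] at h2
    rw [h1, ← hρk]
    set p := ρ ((n : ℝ) - k - 1) with hp
    have hp0 : 0 ≤ p := Real.exp_nonneg _
    set t := δ * (Real.sqrt n * (Real.sqrt (n - k))⁻¹) with ht
    have ht0 : 0 ≤ t := by positivity
    have h3 : W * (1 - p - 5 * t) ≤ max 0 (1 - p) * ((1 - 5 * t) * W) := by
      rcases le_total p 1 with hp1 | hp1
      · rw [max_eq_right (by linarith)]
        have : 0 ≤ p * (5 * t) * W := by positivity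
        linarith
      · rw [max_eq_left (by linarith), zero_mul]
        exact mul_nonpos_of_nonneg_of_nonpos hW0 (by linarith)
    calc W / n * (1 - p - 5 * δ * (Real.sqrt n * (Real.sqrt (n - k))⁻¹))
        = (W * (1 - p - 5 * t)) / n := by rw [ht]; ring
      _ ≤ (max 0 (1 - p) * ((1 - 5 * t) * W)) / n := by gcongr
      _ = max 0 (1 - p) / ((n : ℝ) - k) * (((n : ℝ) - k) / n * ((1 - 5 * t) * W)) := by
          field_simp
      _ ≤ _ := by gcongr
  refine le_trans ?_ (Finset.sum_le_sum hround)
  rw [← Finset.mul_sum, Finset.sum_sub_distrib, Finset.sum_sub_distrib, ← Finset.mul_sum,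
    ← Finset.mul_sum, ← Finset.mul_sum, Finset.sum_const, Finset.card_range, nsmul_one]
  have hs1 : Real.exp 1 * ∑ k ∈ Finset.range n, Real.exp (-((k + 1) * (3 * δ * n)⁻¹)) ≤
      9 * δ * n := by
    have h1 := mul_sum_exp_neg_le (3 * δ * n)⁻¹ n
    have h2 : ∑ k ∈ Finset.range n, Real.exp (-((k + 1) * (3 * δ * n)⁻¹)) ≤ 3 * δ * n := by
      rw [← inv_mul_le_one₀ (by positivity)]
      exact h1.trans (sub_le_self _ (Real.exp_nonneg _))
    calc _ ≤ 3 * (3 * δ * n) := by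
          gcongr
          linarith [Real.exp_one_lt_d9]
      _ = _ := by ring
  have hs2 : Real.sqrt n * ∑ k ∈ Finset.range n, (Real.sqrt ((n : ℝ) - k))⁻¹ ≤ 2 * n := by
    have h1 : ∑ k ∈ Finset.range n, (Real.sqrt ((n : ℝ) - k))⁻¹ =
        ∑ k ∈ Finset.range n, (Real.sqrt ((k : ℝ) + 1))⁻¹ := by
      rw [← Finset.sum_range_reflect]
      refine Finset.sum_congr rfl fun k hk => ?_
      have hk : k < n := Finset.mem_range.1 hk
      rw [Nat.sub_sub, Nat.cast_sub (by omega)]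
      push_cast
      congr 2
      ring
    rw [h1]
    calc _ ≤ Real.sqrt n * (2 * Real.sqrt n) := by
          gcongr
          exact sum_inv_sqrt_le n
      _ = 2 * n := by
          rw [mul_left_comm, Real.mul_self_sqrt hn'.le]
  calc (1 - 19 * δ) * W = W / n * (n - 9 * δ * n - 5 * δ * (2 * n)) := by
        field_simp
        ring
    _ ≤ _ := by gcongr

theorem expectedWelfare_nonneg (A : Solver I) : 0 ≤ expectedWelfare A I.profit := by
  refine tsum_nonneg fun s => ?_
  by_cases hs : s ∈ (mechanism A).support
  · exact mul_nonneg ENNReal.toReal_nonneg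
      (value_nonneg I.profit_nonneg (isIntegralAllocation_of_mem_support A hs).1.1)
  · rw [PMF.mem_support_iff, not_not] at hs
    simp [hs]

theorem OPT_nonneg (I : Instance m n K) : 0 ≤ OPT I := by
  refine Real.sSup_nonneg ?_
  rintro _ ⟨x, hx, rfl⟩
  exact value_nonneg I.profit_nonneg hx.1

theorem HasCapacityRatio.mul_OPT_le {β : ℝ} (h : HasCapacityRatio I β) (A : Solver I) :
    (1 - 19 * Real.sqrt (log' m / β)) * OPT I ≤ expectedWelfare A I.profit := by
  rcases le_or_gt (1 - 19 * Real.sqrt (log' m / β)) 0 with hneg | hpos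
  · exact (mul_nonpos_of_nonpos_of_nonneg hneg (OPT_nonneg I)).trans (expectedWelfare_nonneg A)
  · rw [mul_comm, ← le_div_iff₀ hpos]
    refine csSup_le (Set.Nonempty.image _ ⟨0, fun _ _ => le_rfl, fun i => ?_, by simp, by simp⟩) ?_
    · simpa [usage] using I.cap_nonneg i
    · rintro _ ⟨x, hx, rfl⟩
      rw [le_div_iff₀ hpos, mul_comm]
      exact h.le_expectedWelfare A (by linarith) hx

theorem hasCapacityRatio_of_le {β : ℝ} (hβ : 0 < β)
    (h : ENNReal.ofReal β ≤ capacityRatio I) : HasCapacityRatio I β := by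
  have hi : ∀ i, ENNReal.ofReal β ≤
      ENNReal.ofReal (I.cap i) / ⨆ j, ⨆ k, ENNReal.ofReal (I.demand i j k) :=
    fun i => h.trans (iInf_le _ i)
  refine ⟨hβ, fun i => ?_, fun i j k => ?_⟩
  · by_contra hc
    have := hi i
    rw [ENNReal.ofReal_of_nonpos (not_lt.1 hc), ENNReal.zero_div, nonpos_iff_eq_zero,
      ENNReal.ofReal_eq_zero] at this
    exact absurd hβ (not_lt.2 this)
  · rw [← ENNReal.ofReal_le_ofReal_iff (I.cap_nonneg i), ENNReal.ofReal_mul hβ.le]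
    refine le_trans ?_ (ENNReal.mul_le_of_le_div (hi i))
    gcongr
    exact le_iSup₂ (f := fun j k => ENNReal.ofReal (I.demand i j k)) j k

end OnlinePacking

end

theorem mainTheorem3 :
    ∃ C : ℝ, 0 < C ∧ ∀ (m n K : ℕ) (I : OnlinePacking.Instance m n K)
      (A : OnlinePacking.Solver I), 0 < OnlinePacking.capacityRatio I →
      (∀ s ∈ (OnlinePacking.mechanism A).support, OnlinePacking.IsIntegralAllocation I s.y) ∧
      (1 - C * Real.sqrt
          (ENNReal.ofReal (OnlinePacking.log' m) / OnlinePacking.capacityRatio I).toReal) *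
        OnlinePacking.OPT I ≤ OnlinePacking.expectedWelfare A I.profit := by
  refine ⟨19, by norm_num, fun m n K I A hB =>
    ⟨fun s hs => OnlinePacking.isIntegralAllocation_of_mem_support A hs, ?_⟩⟩
  have hL : 0 < OnlinePacking.log' m := zero_lt_one.trans_le (OnlinePacking.one_le_log' m)
  by_cases htop : OnlinePacking.capacityRatio I = ⊤
  · -- With an infinite capacity ratio the bound holds for every `β`, so the error term vanishes.
    have hlim : Filter.Tendsto (fun ε : ℝ => (1 - 19 * ε) * OnlinePacking.OPT I)
        (nhdsWithin 0 (Set.Ioi 0)) (nhds ((1 - 19 * 0) * OnlinePacking.OPT I)) := by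
      refine Filter.Tendsto.mono_left (Continuous.tendsto ?_ 0) nhdsWithin_le_nhds
      fun_prop
    simp only [htop, ENNReal.div_top, ENNReal.toReal_zero, Real.sqrt_zero]
    refine le_of_tendsto hlim ?_
    filter_upwards [self_mem_nhdsWithin] with ε hε
    have hε : 0 < ε := hε
    have h := (OnlinePacking.hasCapacityRatio_of_le (I := I)
      (by positivity : 0 < OnlinePacking.log' m / ε ^ 2) (htop ▸ le_top)).mul_OPT_le A
    rwa [div_div_cancel₀ hL.ne', Real.sqrt_sq hε.le] at h
  · have h := (OnlinePacking.hasCapacityRatio_of_le (ENNReal.toReal_pos hB.ne' htop)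
      (ENNReal.ofReal_toReal htop).le).mul_OPT_le A
    rwa [ENNReal.toReal_div, ENNReal.toReal_ofReal hL.le]
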